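/- Let $0<q<1$. Let $\mathrm{Pol}(\widetilde X)_q$ (resp. $\mathrm{Pol}(\widetilde\Xi)_q$) be the complex algebra with generators $t_{11},t_{12},t_{21},t_{22}$ and relations $$t_{11}t_{12}=qt_{12}t_{11},\quad t_{21}t_{22}=qt_{22}t_{21},\quad t_{11}t_{21}=qt_{21}t_{11},\quad t_{12}t_{22}=qt_{22}t_{12},\quad t_{12}t_{21}=t_{21}t_{12},$$ $$t_{11}t_{22}-t_{22}t_{11}=(q-q^{-1})t_{12}t_{21},\qquad t_{11}t_{22}-qt_{12}t_{21}=c,$$ with $c=1$ (resp. $c=0$). Put $t_{11}^*=-t_{22}$, $t_{12}^*=-qt_{21}$, $x=t_{12}t_{12}^*$. For $Y\in\{\widetilde X,\widetilde\Xi\}$ let $G_Y=q^{-2\mathbb Z_+}$ if $Y=\widetilde X$ and $G_Y=q^{2\mathbb Z}$ if $Y=\widetilde\Xi$. The space $D(Y)_q'$ of distributions consists of the formal series $$f=\sum_{i_1j_1=i_2j_2=0}t_{11}^{i_1}t_{12}^{i_2}\,\psi_{i_1i_2j_1j_2}(x)\,t_{12}^{*j_2}t_{11}^{*j_1},\qquad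 \psi_{i_1i_2j_1j_2}:G_Y\to\mathbb C,$$ and $D(Y)_q$ is the space of finite functions, i.e. of series for which only finitely many of the values $\psi_{i_1i_2j_1j_2}(a)$, $a\in G_Y$, are nonzero. Each element of $\mathrm{Pol}(Y)_q$ has a unique expansion of this form with polynomial coefficients and is thereby regarded as a distribution; $D(Y)_q$ is an algebra, its product being the extension of that of $\mathrm{Pol}(Y)_q$ by continuity (for pointwise convergence of coefficients). On $D(Y)_q$ put $\int f\,d\nu=(1-q^2)\sum_{a\in G_Y}\psi_{0000}(a)\,a$. For $Y_1,Y_2\in\{\widetilde X,\widetilde\Xi\}$ let $\mathrm{Pol}(Y_1\times Y_2)_q=\mathrm{Pol}(Y_1)_q^{\mathrm{op}}\otimes\mathrm{Pol}(Y_2)_q$, $D(Y_1\times Y_2)_q=D(Y_1)_q^{\mathrm{op}}\otimes D(Y_2)_q$, and let $D(Y_1\times Y_2)_q'\supset\mathrm{Pol}(Y_1\times Y_2)_q$ be the space of the corresponding formal series in both groups of variables, whose coefficients are arbitrary functions on $G_{Y_1}\times G_{Y_2}$, with the topology of pointwise convergence of the coefficients. The bilinear form $(\psi,\varphi)\mapsto\iint\psi\varphi\,d\nu_1d\nu_2$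 on $D(Y_1\times Y_2)_q$ extends by continuity in the first argument to a pairing of $D(Y_1\times Y_2)_q'$ with $D(Y_1\times Y_2)_q$. Write $t_{ij}=t_{ij}\otimes1$, $\tau_{ij}=1\otimes t_{ij}$ in $\mathrm{Pol}(Y_1\times Y_2)_q$ and $$k_{11}=t_{11}\tau_{22}-qt_{12}\tau_{21},\qquad k_{22}=-q^{-1}t_{21}\tau_{12}+t_{22}\tau_{11}.$$ Let $q=e^{-h/2}$. The generators $H,X^{\pm}$ of $U_q\mathfrak{sl}_2$ act on $\mathrm{Pol}(Y)_q$ by zero on $1$, by $Ht_{i1}=t_{i1}$, $Ht_{i2}=-t_{i2}$, $X^+t_{i1}=0$, $X^+t_{i2}=t_{i1}$, $X^-t_{i1}=t_{i2}$, $X^-t_{i2}=0$, and on products and tensor products through $\Delta(H)=H\otimes1+1\otimes H$, $\Delta(X^\pm)=X^\pm\otimes e^{hH/4}+e^{-hH/4}\otimes X^\pm$. The action on $\mathrm{Pol}(Y_1\times Y_2)_q$ extends by continuity to $D(Y_1\times Y_2)_q'$, and $K\in D(Y_1\times Y_2)_q'$ is called invariant if $HK=X^+K=X^-K=0$. A function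 $f:\mathbb C\setminus\{0\}\to D(Y_1\times Y_2)_q'$ is called polynomial if for every $\varphi\in D(Y_1\times Y_2)_q$ the pairing $\iint f(\lambda)\varphi\,d\nu_1d\nu_2$ is a Laurent polynomial in $\lambda$. **Proposition.** Let $D(Y_1\times Y_2)_q'$ be any one of the three spaces $D(\widetilde X\times\widetilde X)_q'$, $D(\widetilde X\times\widetilde\Xi)_q'$, $D(\widetilde\Xi\times\widetilde X)_q'$. There exists a unique polynomial function $f:\mathbb C\setminus\{0\}\to D(Y_1\times Y_2)_q'$ such that $f(q^{2l})=k_{22}^l\,k_{11}^l$ for all integers $l\ge0$. Moreover, $f(\lambda)$ is invariant for every $\lambda\in\mathbb C\setminus\{0\}$; in particular $f(q^{2l})$ is invariant for every $l\in\mathbb C$. -/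

import Mathlib

open scoped TensorProduct

noncomputable section

namespace QKernel

/-- The two quantum `SU(1,1)`-spaces: the principal homogeneous space `X̃` and the cone `Ξ̃`. -/
inductive QSpace
  | X
  | Xi


/-- The right-hand side of `t₁₁ t₂₂ - q t₁₂ t₂₁ = c`: it is `1` for `X̃` and `0` for `Ξ̃`. -/
def QSpace.c : QSpace → ℂ
  | .X => 1
  | .Xi => 0

/-- The deformation parameter is a real number `0 < q < 1`. -/
abbrev Par := Set.Ioo (0 : ℝ) 1

/-- `q` as a complex number. -/
def qc (q : Par) : ℂ := ((q : ℝ) : ℂ)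

/-- `q^{1/2} = e^{-h/4}` as a complex number, where `q = e^{-h/2}`. -/
def qh (q : Par) : ℂ := ((Real.sqrt (q : ℝ) : ℝ) : ℂ)

theorem qc_ne_zero (q : Par) : qc q ≠ 0 := by
  unfold qc
  exact_mod_cast q.2.1.ne'

theorem qh_mul_self (q : Par) : qh q * qh q = qc q := by
  unfold qh qc
  exact_mod_cast Real.mul_self_sqrt q.2.1.le

theorem qh_ne_zero (q : Par) : qh q ≠ 0 := by
  intro h
  have := qh_mul_self q
  rw [h, zero_mul] at this
  exact qc_ne_zero q this.symm

/-! ### The polynomial algebras -/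

/-- Free generators; the pair `(i, j)` of indices in `{0, 1}` stands for `t_{i+1, j+1}`. -/
abbrev Free := FreeAlgebra ℂ (Fin 2 × Fin 2)

/-- The generator of the free algebra. -/
abbrev g (i j : Fin 2) : Free := FreeAlgebra.ι ℂ (i, j)

/-- The defining relations of `Pol(X̃)_q` (`c = 1`) and `Pol(Ξ̃)_q` (`c = 0`). -/
inductive Rel (q : Par) (Y : QSpace) : Free → Free → Prop
  | r1112 : Rel q Y (g 0 0 * g 0 1) (qc q • (g 0 1 * g 0 0))
  | r2122 : Rel q Y (g 1 0 * g 1 1) (qc q • (g 1 1 * g 1 0))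
  | r1121 : Rel q Y (g 0 0 * g 1 0) (qc q • (g 1 0 * g 0 0))
  | r1222 : Rel q Y (g 0 1 * g 1 1) (qc q • (g 1 1 * g 0 1))
  | r1221 : Rel q Y (g 0 1 * g 1 0) (g 1 0 * g 0 1)
  | r1122 : Rel q Y (g 0 0 * g 1 1 - g 1 1 * g 0 0)
      ((qc q - (qc q)⁻¹) • (g 0 1 * g 1 0))
  | rdet : Rel q Y (g 0 0 * g 1 1 - qc q • (g 0 1 * g 1 0)) (algebraMap ℂ Free Y.c)

/-- The algebra `Pol(Y)_q`. -/
abbrev Pol (q : Par) (Y : QSpace) := RingQuot (Rel q Y)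

/-- The generators of `Pol(Y)_q`: `t 0 0, t 0 1, t 1 0, t 1 1` are `t₁₁, t₁₂, t₂₁, t₂₂`. -/
def t (q : Par) (Y : QSpace) (i j : Fin 2) : Pol q Y := RingQuot.mkAlgHom ℂ (Rel q Y) (g i j)

/-- `t₁₁* = -t₂₂`. -/
def t11s (q : Par) (Y : QSpace) : Pol q Y := -t q Y 1 1

/-- `t₁₂* = -q t₂₁`. -/
def t12s (q : Par) (Y : QSpace) : Pol q Y := -(qc q • t q Y 1 0)

/-- `x = t₁₂ t₁₂*`. -/
def xPol (q : Par) (Y : QSpace) : Pol q Y := t q Y 0 1 * t12s q Y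

/-! ### Formal series: distributions and finite functions -/

/-- Index of one value `ψ_{i₁ i₂ j₁ j₂}(q^{-2m})` of a coefficient of a formal series
`∑ t₁₁^{i₁} t₁₂^{i₂} ψ_{i₁ i₂ j₁ j₂}(x) t₁₂*^{j₂} t₁₁*^{j₁}`, `i₁ j₁ = i₂ j₂ = 0`. The argument
`x = q^{-2m}` runs over `q^{-2ℤ₊}` for `X̃` and over `q^{2ℤ}` for `Ξ̃`. -/
@[ext]
structure Idx (Y : QSpace) where
  i₁ : ℕ
  i₂ : ℕ
  j₁ : ℕ
  j₂ : ℕ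
  m : ℤ
  h₁ : i₁ * j₁ = 0
  h₂ : i₂ * j₂ = 0
  hm : Y = .X → 0 ≤ m

/-- The index of `ψ_{0000}(q^{-2m})`. -/
def Idx.zero {Y : QSpace} (m : {m : ℤ // Y = .X → 0 ≤ m}) : Idx Y := ⟨0, 0, 0, 0, m.1, rfl, rfl, m.2⟩

/-- `D(Y)_q'`: formal series, given by the values of their coefficients. -/
abbrev Dist (Y : QSpace) := Idx Y → ℂ

/-- `D(Y₁ × Y₂)_q'`: formal series in both groups of variables (the monomials of the first factor
being written in the opposite algebra), whose coefficients are functions on the product of the two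
progressions. The product topology is that of pointwise convergence of the coefficients. -/
abbrev Dist₂ (Y₁ Y₂ : QSpace) := Idx Y₁ × Idx Y₂ → ℂ

/-- `D(Y₁ × Y₂)_q = D(Y₁)_q^op ⊗ D(Y₂)_q`: the finite functions. The basis vector at `(α, β)` is
`E_α ⊗ E_β`, where `E_α = t₁₁^{i₁} t₁₂^{i₂} δ_m(x) t₁₂*^{j₂} t₁₁*^{j₁}` and `δ_m` is the function
equal to `1` at `q^{-2m}` and to `0` at the other points of the progression. -/
abbrev Fin₂ (Y₁ Y₂ : QSpace) := Idx Y₁ × Idx Y₂ →₀ ℂ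

/-! ### Realization by operators

`Pol(Y)_q` and the functions of `x` act on the vector space with basis `|m, n⟩`; `x` acts
diagonally, by `q^{-2m}`, and a function `ψ(x)` by `ψ(q^{-2m})`. For `X̃` the vectors with `m ≥ 0`
span an invariant subspace, and only matrix elements within this subspace are used. -/

/-- The space with basis `|m, n⟩`. -/
abbrev V := ℤ × ℤ →₀ ℂ

/-- The weighted shift `|m, n⟩ ↦ w(m) |m + d₁, n + d₂⟩`. -/
def wshift (d : ℤ × ℤ) (w : ℤ → ℂ) : Module.End ℂ V :=
  Finsupp.linearCombination ℂ (fun p : ℤ × ℤ => Finsupp.single (p + d) (w p.1))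

theorem wshift_single (d : ℤ × ℤ) (w : ℤ → ℂ) (p : ℤ × ℤ) (a : ℂ) :
    wshift d w (Finsupp.single p a) = Finsupp.single (p + d) (a * w p.1) := by
  simp [wshift]

theorem wshift_mul (d e : ℤ × ℤ) (w v : ℤ → ℂ) :
    wshift d w * wshift e v = wshift (d + e) (fun m => v m * w (m + e.1)) := by
  refine Finsupp.lhom_ext fun p a => ?_
  rw [Module.End.mul_apply, wshift_single, wshift_single, wshift_single, add_assoc, add_comm e d,
    mul_assoc]
  rfl

theorem wshift_smul (r : ℂ) (d : ℤ × ℤ) (w : ℤ → ℂ) :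
    r • wshift d w = wshift d (fun m => r * w m) := by
  refine Finsupp.lhom_ext fun p a => ?_
  rw [LinearMap.smul_apply, wshift_single, wshift_single, Finsupp.smul_single, smul_eq_mul]
  congr 1
  ring

theorem wshift_sub (d : ℤ × ℤ) (w v : ℤ → ℂ) :
    wshift d w - wshift d v = wshift d (fun m => w m - v m) := by
  refine Finsupp.lhom_ext fun p a => ?_
  rw [LinearMap.sub_apply, wshift_single, wshift_single, wshift_single, ← Finsupp.single_sub,
    mul_sub]

theorem wshift_const (r : ℂ) : wshift 0 (fun _ => r) = algebraMap ℂ (Module.End ℂ V) r := by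
  refine Finsupp.lhom_ext fun p a => ?_
  rw [wshift_single, Module.algebraMap_end_apply, Finsupp.smul_single, smul_eq_mul, add_zero,
    mul_comm]

/-- The operators of the generators. -/
def rhoGen (q : Par) (Y : QSpace) : Fin 2 × Fin 2 → Module.End ℂ V
  | (0, 0) => wshift (1, 0) (fun _ => 1)
  | (0, 1) => wshift (0, 1) (fun m => qc q ^ (-m))
  | (1, 0) => wshift (0, -1) (fun m => -((qc q)⁻¹ * qc q ^ (-m)))
  | (1, 1) => wshift (-1, 0) (fun m => -(qc q ^ (-2 * m) - Y.c))

theorem rhoGen_rel (q : Par) (Y : QSpace) ⦃a b : Free⦄ (h : Rel q Y a b) :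
    FreeAlgebra.lift ℂ (rhoGen q Y) a = FreeAlgebra.lift ℂ (rhoGen q Y) b := by
  have hq := qc_ne_zero q
  have e2 (m : ℤ) : qc q ^ (-2 * m) = qc q ^ (-m) * qc q ^ (-m) := by
    rw [← zpow_add₀ hq]; congr 1; ring
  have e1 (m : ℤ) : qc q ^ (-(m + 1)) = qc q ^ (-m) * (qc q)⁻¹ := by
    rw [neg_add, zpow_add₀ hq, zpow_neg_one]
  have e3 (m : ℤ) : qc q ^ (-(m + -1)) = qc q ^ (-m) * qc q := by
    rw [neg_add, zpow_add₀ hq, neg_neg, zpow_one]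
  cases h <;>
    simp only [map_mul, map_smul, map_sub, AlgHom.commutes, FreeAlgebra.lift_ι_apply, rhoGen,
      wshift_mul, wshift_smul, Prod.mk_add_mk, add_zero, zero_add, add_neg_cancel, neg_add_cancel,
      wshift_sub, ← wshift_const, Prod.mk_zero_zero]
  all_goals
    congr 1
    funext m
    try simp only [e2, e1, e3]
    field_simp
    try ring

/-- The representation of `Pol(Y)_q` in `V`. -/
def rho (q : Par) (Y : QSpace) : Pol q Y →ₐ[ℂ] Module.End ℂ V :=
  RingQuot.liftAlgHom ℂ ⟨FreeAlgebra.lift ℂ (rhoGen q Y), rhoGen_rel q Y⟩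

theorem rho_t (q : Par) (Y : QSpace) (i j : Fin 2) : rho q Y (t q Y i j) = rhoGen q Y (i, j) := by
  simp [rho, t]

theorem rho_t11s (q : Par) (Y : QSpace) :
    rho q Y (t11s q Y) = wshift (-1, 0) (fun m => qc q ^ (-2 * m) - Y.c) := by
  rw [t11s, map_neg, rho_t, ← neg_one_smul ℂ, rhoGen, wshift_smul]
  simp

theorem rho_t12s (q : Par) (Y : QSpace) :
    rho q Y (t12s q Y) = wshift (0, -1) (fun m => qc q ^ (-m)) := by
  have hq := qc_ne_zero q
  rw [t12s, map_neg, map_smul, rho_t, ← neg_one_smul ℂ, rhoGen, wshift_smul, wshift_smul]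
  congr 1
  funext m
  field_simp

/-- In the realization, `x` acts diagonally by `q^{-2m}`. -/
theorem rho_xPol (q : Par) (Y : QSpace) :
    rho q Y (xPol q Y) = wshift 0 (fun m => qc q ^ (-2 * m)) := by
  have hq := qc_ne_zero q
  rw [xPol, map_mul, rho_t, rho_t12s, rhoGen, wshift_mul, Prod.mk_add_mk, add_zero,
    add_neg_cancel, Prod.mk_zero_zero]
  congr 1
  · funext m
    rw [add_zero, ← zpow_add₀ hq, ← two_mul, neg_mul, mul_neg]

/-- The operator `t₁₁^{i₁} t₁₂^{i₂} ψ(x) t₁₂*^{j₂} t₁₁*^{j₁}`, where `ψ(q^{-2m}) = w(m)`. -/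
def termOp (q : Par) (Y : QSpace) (i₁ i₂ j₁ j₂ : ℕ) (w : ℤ → ℂ) : Module.End ℂ V :=
  rho q Y (t q Y 0 0 ^ i₁ * t q Y 0 1 ^ i₂) * wshift 0 w *
    rho q Y (t12s q Y ^ j₂ * t11s q Y ^ j₁)

/-- The operator of the finite function `E_α`. -/
def finOp (q : Par) {Y : QSpace} (α : Idx Y) : Module.End ℂ V :=
  termOp q Y α.i₁ α.i₂ α.j₁ α.j₂ (Pi.single α.m 1)

/-- The only nonzero matrix element, up to shifts of `n`, of `E_α`. -/
def entry {Y : QSpace} (α : Idx Y) : Module.End ℂ V →ₗ[ℂ] ℂ :=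
  Finsupp.lapply (α.m + α.i₁, (α.i₂ : ℤ) - α.j₂) ∘ₗ
    LinearMap.applyₗ (Finsupp.single (α.m + α.j₁, (0 : ℤ)) (1 : ℂ))

/-- The value `ψ_{i₁ i₂ j₁ j₂}(q^{-2m})`, where `α = (i₁, i₂, j₁, j₂, m)`, of the coefficient of an
operator in its expansion `∑ t₁₁^{i₁} t₁₂^{i₂} ψ_{i₁ i₂ j₁ j₂}(x) t₁₂*^{j₂} t₁₁*^{j₁}`. -/
def coeff (q : Par) {Y : QSpace} (α : Idx Y) : Module.End ℂ V →ₗ[ℂ] ℂ :=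
  (entry α (finOp q α))⁻¹ • entry α

theorem wshift_pow (d : ℤ × ℤ) (w : ℤ → ℂ) (k : ℕ) :
    wshift d w ^ k = wshift (k • d) (fun m => ∏ s ∈ Finset.range k, w (m + s * d.1)) := by
  induction k with
  | zero =>
    rw [pow_zero, zero_smul]
    simp [wshift_const]
  | succ k ih =>
    rw [pow_succ', ih, wshift_mul]
    congr 1
    · rw [succ_nsmul']
    · funext m
      rw [Finset.prod_range_succ]
      simp

theorem termOp_eq (q : Par) (Y : QSpace) (i₁ i₂ j₁ j₂ : ℕ) (w : ℤ → ℂ) :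
    termOp q Y i₁ i₂ j₁ j₂ w = wshift ((i₁ : ℤ) - j₁, (i₂ : ℤ) - j₂) (fun m =>
      (∏ s ∈ Finset.range j₁, (qc q ^ (-2 * (m - s)) - Y.c)) * (qc q ^ (-(m - j₁))) ^ j₂ *
        w (m - j₁) * (qc q ^ (-(m - j₁))) ^ i₂) := by
  simp only [termOp, map_mul, map_pow, rho_t, rho_t12s, rho_t11s, rhoGen, wshift_pow, wshift_mul]
  congr 1
  · ext <;> simp <;> ring
  · funext m
    simp [sub_eq_add_neg]
    ring

theorem entry_termOp (q : Par) {Y : QSpace} (α β : Idx Y) (w : ℤ → ℂ) :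
    entry α (termOp q Y β.i₁ β.i₂ β.j₁ β.j₂ w) =
      if α.i₁ = β.i₁ ∧ α.i₂ = β.i₂ ∧ α.j₁ = β.j₁ ∧ α.j₂ = β.j₂ then
        (∏ s ∈ Finset.range α.j₁, (qc q ^ (-2 * (α.m + α.j₁ - s)) - Y.c)) *
          (qc q ^ (-α.m)) ^ α.j₂ * w α.m * (qc q ^ (-α.m)) ^ α.i₂ else 0 := by
  have h1 := α.h₁
  have h2 := α.h₂
  have h3 := β.h₁
  have h4 := β.h₂
  simp only [Nat.mul_eq_zero] at h1 h2 h3 h4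
  rw [termOp_eq]
  simp only [entry, LinearMap.comp_apply, LinearMap.applyₗ_apply_apply, wshift_single,
    Finsupp.lapply_apply, Finsupp.single_apply, Prod.mk_add_mk, Prod.mk.injEq]
  split_ifs with hA hB hB
  · obtain ⟨a, b, c, d⟩ := hB
    simp [b, c, d]
  · exfalso; omega
  · exfalso; omega
  · rfl

theorem weight_ne_zero (q : Par) (Y : QSpace) (m : ℤ) (hm : Y = .X → 0 < m) :
    qc q ^ (-2 * m) - Y.c ≠ 0 := by
  cases Y with
  | Xi => simpa [QSpace.c] using zpow_ne_zero _ (qc_ne_zero q)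
  | X =>
    have h := hm rfl
    have h0 := q.2.1
    have h1 := q.2.2
    have : (1 : ℝ) < (q : ℝ) ^ (-2 * m) := by
      rw [neg_mul, zpow_neg, one_lt_inv₀ (by positivity)]
      exact zpow_lt_one₀ h0 h1 (by omega)
    intro h2
    rw [sub_eq_zero, QSpace.c, qc] at h2
    have h3 : (q : ℝ) ^ (-2 * m) = 1 := by exact_mod_cast h2
    exact this.ne' h3

theorem entry_finOp_ne_zero (q : Par) {Y : QSpace} (α : Idx Y) : entry α (finOp q α) ≠ 0 := by
  have hq := qc_ne_zero q
  rw [finOp, entry_termOp]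
  simp only [and_self, if_true, Pi.single_eq_same, mul_one]
  refine mul_ne_zero (mul_ne_zero (Finset.prod_ne_zero_iff.2 fun s hs => ?_) ?_) ?_
  · refine weight_ne_zero q Y _ fun h => ?_
    have := α.hm h
    have := Finset.mem_range.1 hs
    omega
  · exact pow_ne_zero _ (zpow_ne_zero _ hq)
  · exact pow_ne_zero _ (zpow_ne_zero _ hq)

/-- The series of `t₁₁^{i₁} t₁₂^{i₂} ψ(x) t₁₂*^{j₂} t₁₁*^{j₁}` is the expected one. -/
theorem coeff_termOp (q : Par) {Y : QSpace} (α β : Idx Y) (w : ℤ → ℂ) :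
    coeff q α (termOp q Y β.i₁ β.i₂ β.j₁ β.j₂ w) =
      if α.i₁ = β.i₁ ∧ α.i₂ = β.i₂ ∧ α.j₁ = β.j₁ ∧ α.j₂ = β.j₂ then w α.m else 0 := by
  have h := entry_finOp_ne_zero q α
  rw [coeff, LinearMap.smul_apply, smul_eq_mul, inv_mul_eq_div, div_eq_iff h, entry_termOp, finOp,
    entry_termOp]
  simp only [and_self, if_true, Pi.single_eq_same, mul_one]
  split_ifs
  · ring
  · ring

/-- The values of the coefficients in the expansion of a polynomial. -/
def polCoeff (q : Par) {Y : QSpace} (α : Idx Y) : Pol q Y →ₗ[ℂ] ℂ :=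
  coeff q α ∘ₗ (rho q Y).toLinearMap

/-- The expansion of a normally ordered polynomial is the expected one; since such polynomials span
`Pol(Y)_q`, this determines `polCoeff`. -/
theorem polCoeff_normal (q : Par) {Y : QSpace} (α β : Idx Y) (P : Polynomial ℂ) :
    polCoeff q α (t q Y 0 0 ^ β.i₁ * t q Y 0 1 ^ β.i₂ * Polynomial.aeval (xPol q Y) P *
        (t12s q Y ^ β.j₂ * t11s q Y ^ β.j₁)) =
      if α.i₁ = β.i₁ ∧ α.i₂ = β.i₂ ∧ α.j₁ = β.j₁ ∧ α.j₂ = β.j₂ then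
        P.eval (qc q ^ (-2 * α.m)) else 0 := by
  have hP : rho q Y (Polynomial.aeval (xPol q Y) P) =
      wshift 0 (fun m => P.eval (qc q ^ (-2 * m))) := by
    rw [← Polynomial.aeval_algHom_apply, rho_xPol]
    refine Finsupp.lhom_ext fun p a => ?_
    induction P using Polynomial.induction_on' with
    | add P Q hP hQ =>
      rw [map_add, LinearMap.add_apply, hP, hQ, wshift_single, wshift_single, wshift_single,
        ← Finsupp.single_add, Polynomial.eval_add, mul_add]
    | monomial n r =>
      rw [Polynomial.aeval_monomial, wshift_pow, ← wshift_const, wshift_mul]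
      simp [wshift_single, mul_comm]
  rw [← coeff_termOp q α β (fun m => P.eval (qc q ^ (-2 * m)))]
  rw [polCoeff, LinearMap.comp_apply, AlgHom.toLinearMap_apply, termOp, map_mul (rho q Y),
    map_mul (rho q Y), hP]

/-! ### Integrals and the pairing -/

/-- The invariant integral `ν(f) = (1 - q²) ∑ ψ_{0000}(q^{-2m}) q^{-2m}`, the sum being over the
progression of `Y`; it is used for finite functions only. -/
def nu (q : Par) {Y : QSpace} (f : Dist Y) : ℂ :=
  (1 - qc q ^ 2) * ∑ᶠ m : {m : ℤ // Y = .X → 0 ≤ m}, f (Idx.zero m) * qc q ^ (-2 * (m : ℤ))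

/-- The integral `ν(E_α E_β)` of the product of two finite functions. -/
def nuMul (q : Par) {Y : QSpace} (α β : Idx Y) : ℂ :=
  nu q (fun γ : Idx Y => coeff q γ (finOp q α * finOp q β))

/-- The bilinear form `∫∫ {ψ φ} dν₁ dν₂` on finite functions. The product `ψ φ` is taken in
`D(Y₁)_q^op ⊗ D(Y₂)_q`, that is, `(ψ₁ ⊗ ψ₂)(φ₁ ⊗ φ₂) = φ₁ ψ₁ ⊗ ψ₂ φ₂`. -/
def form (q : Par) {Y₁ Y₂ : QSpace} (ψ φ : Fin₂ Y₁ Y₂) : ℂ :=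
  ψ.sum fun p a => φ.sum fun r b => a * b * (nuMul q r.1 p.1 * nuMul q p.2 r.2)

/-- The pairing `∫∫ {K φ} dν₁ dν₂` of a distribution and a finite function: the extension of the
form by continuity in the first argument. Only finitely many summands are nonzero. -/
def pair (q : Par) {Y₁ Y₂ : QSpace} (K : Dist₂ Y₁ Y₂) (φ : Fin₂ Y₁ Y₂) : ℂ :=
  ∑ᶠ p : Idx Y₁ × Idx Y₂, K p * form q (Finsupp.single p 1) φ

theorem nuMul_ne_zero (q : Par) {Y : QSpace} (α β : Idx Y) (h : nuMul q α β ≠ 0) :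
    α.i₁ = β.j₁ ∧ α.j₁ = β.i₁ ∧ α.i₂ = β.j₂ ∧ α.j₂ = β.i₂ ∧ α.m = β.m := by
  have h1 := α.h₁
  have h2 := α.h₂
  have h3 := β.h₁
  have h4 := β.h₂
  simp only [Nat.mul_eq_zero] at h1 h2 h3 h4
  by_contra hne
  refine h ?_
  rw [nuMul, nu]
  refine mul_eq_zero_of_right _ ?_
  refine finsum_eq_zero_of_forall_eq_zero fun m => ?_
  refine mul_eq_zero_of_left ?_ _
  rw [coeff, LinearMap.smul_apply]
  refine smul_eq_zero_of_right _ ?_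
  simp only [finOp, termOp_eq, wshift_mul, entry, LinearMap.comp_apply,
    LinearMap.applyₗ_apply_apply, wshift_single, Finsupp.lapply_apply, Finsupp.single_apply,
    Prod.mk_add_mk, Prod.mk.injEq, Idx.zero, Pi.single_apply]
  split_ifs <;> first | (exfalso; omega) | simp

theorem Idx.ext_partner {Y : QSpace} {α β γ : Idx Y}
    (h : α.i₁ = β.j₁ ∧ α.j₁ = β.i₁ ∧ α.i₂ = β.j₂ ∧ α.j₂ = β.i₂ ∧ α.m = β.m)
    (h' : α.i₁ = γ.j₁ ∧ α.j₁ = γ.i₁ ∧ α.i₂ = γ.j₂ ∧ α.j₂ = γ.i₂ ∧ α.m = γ.m) : β = γ := by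
  apply Idx.ext <;> omega

theorem form_finite (q : Par) {Y₁ Y₂ : QSpace} (φ : Fin₂ Y₁ Y₂) :
    {p : Idx Y₁ × Idx Y₂ | form q (Finsupp.single p 1) φ ≠ 0}.Finite := by
  have hs : {p : Idx Y₁ × Idx Y₂ | form q (Finsupp.single p 1) φ ≠ 0} ⊆
      ⋃ r ∈ φ.support, {p | nuMul q r.1 p.1 ≠ 0 ∧ nuMul q p.2 r.2 ≠ 0} := by
    intro p hp
    rw [Set.mem_ofPred_eq, form, Finsupp.sum_single_index (by simp), Finsupp.sum] at hp
    obtain ⟨r, hr, hr'⟩ := Finset.exists_ne_zero_of_sum_ne_zero hp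
    simp only [Set.mem_iUnion]
    exact ⟨r, hr, left_ne_zero_of_mul (right_ne_zero_of_mul hr'),
      right_ne_zero_of_mul (right_ne_zero_of_mul hr')⟩
  refine Set.Finite.subset (Set.Finite.biUnion φ.support.finite_toSet fun r _ => ?_) hs
  refine Set.Subsingleton.finite fun p hp p' hp' => ?_
  have a := nuMul_ne_zero q _ _ hp.1
  have a' := nuMul_ne_zero q _ _ hp'.1
  have b := nuMul_ne_zero q _ _ hp.2
  have b' := nuMul_ne_zero q _ _ hp'.2
  refine Prod.ext (Idx.ext_partner a a') ?_
  apply Idx.ext <;> omega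

/-- The pairing extends the form. -/
theorem pair_coe (q : Par) {Y₁ Y₂ : QSpace} (ψ φ : Fin₂ Y₁ Y₂) : pair q ψ φ = form q ψ φ := by
  rw [pair, finsum_eq_sum_of_support_subset (s := ψ.support), form, Finsupp.sum]
  · refine Finset.sum_congr rfl fun p _ => ?_
    rw [form, Finsupp.sum_single_index (by simp), Finsupp.mul_sum]
    refine Finset.sum_congr rfl fun r _ => ?_
    ring
  · intro p hp
    exact Finsupp.mem_support_iff.2 (left_ne_zero_of_mul hp)

/-- The pairing is continuous in the distribution. -/
theorem continuous_pair (q : Par) {Y₁ Y₂ : QSpace} (φ : Fin₂ Y₁ Y₂) :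
    Continuous fun K : Dist₂ Y₁ Y₂ => pair q K φ := by
  have : (fun K : Dist₂ Y₁ Y₂ => pair q K φ) = fun K =>
      ∑ p ∈ (form_finite q φ).toFinset, K p * form q (Finsupp.single p 1) φ := by
    funext K
    rw [pair]
    refine finsum_eq_sum_of_support_subset _ fun p hp => ?_
    simpa using right_ne_zero_of_mul hp
  rw [this]
  fun_prop

/-! ### Polynomial kernels -/

/-- `Pol(Y₁ × Y₂)_q = Pol(Y₁)_q^op ⊗ Pol(Y₂)_q`. -/
abbrev Pol₂ (q : Par) (Y₁ Y₂ : QSpace) := (Pol q Y₁)ᵐᵒᵖ ⊗[ℂ] Pol q Y₂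

/-- The generator `t_{i+1,j+1} ⊗ 1`. -/
def tl (q : Par) (Y₁ Y₂ : QSpace) (i j : Fin 2) : Pol₂ q Y₁ Y₂ := MulOpposite.op (t q Y₁ i j) ⊗ₜ 1

/-- The generator `τ_{i+1,j+1} = 1 ⊗ t_{i+1,j+1}`. -/
def tr (q : Par) (Y₁ Y₂ : QSpace) (i j : Fin 2) : Pol₂ q Y₁ Y₂ := 1 ⊗ₜ t q Y₂ i j

/-- `k₁₁ = t₁₁ τ₂₂ - q t₁₂ τ₂₁`. -/
def k11 (q : Par) (Y₁ Y₂ : QSpace) : Pol₂ q Y₁ Y₂ :=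
  tl q Y₁ Y₂ 0 0 * tr q Y₁ Y₂ 1 1 - qc q • (tl q Y₁ Y₂ 0 1 * tr q Y₁ Y₂ 1 0)

/-- `k₂₂ = -q⁻¹ t₂₁ τ₁₂ + t₂₂ τ₁₁`. -/
def k22 (q : Par) (Y₁ Y₂ : QSpace) : Pol₂ q Y₁ Y₂ :=
  -((qc q)⁻¹ • (tl q Y₁ Y₂ 1 0 * tr q Y₁ Y₂ 0 1)) + tl q Y₁ Y₂ 1 1 * tr q Y₁ Y₂ 0 0

/-- The embedding of `Pol(Y₁ × Y₂)_q` into `D(Y₁ × Y₂)_q'`: a polynomial goes to its expansion. -/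
def toDist (q : Par) (Y₁ Y₂ : QSpace) : Pol₂ q Y₁ Y₂ →ₗ[ℂ] Dist₂ Y₁ Y₂ :=
  LinearMap.pi fun p => LinearMap.mul' ℂ ℂ ∘ₗ
    TensorProduct.map (polCoeff q p.1 ∘ₗ (MulOpposite.opLinearEquiv ℂ).symm.toLinearMap)
      (polCoeff q p.2)

theorem toDist_tmul (q : Par) (Y₁ Y₂ : QSpace) (a : Pol q Y₁) (b : Pol q Y₂)
    (p : Idx Y₁ × Idx Y₂) :
    toDist q Y₁ Y₂ (MulOpposite.op a ⊗ₜ b) p = polCoeff q p.1 a * polCoeff q p.2 b := by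
  simp [toDist]

/-! ### The action of `U_q sl₂` and invariance -/

/-- The generators `H`, `X⁺`, `X⁻` of `U_q sl₂`. -/
inductive UGen
  | H
  | Xp
  | Xm

/-- The upper triangular matrix `(a, b; 0, d)`. -/
def tri {R : Type*} [Ring R] (a b d : R) : Matrix (Fin 2) (Fin 2) R := !![a, b; 0, d]

theorem tri_mul {R : Type*} [Ring R] (a b d a' b' d' : R) :
    tri a b d * tri a' b' d' = tri (a * a') (a * b' + b * d') (d * d') := by
  simp [tri]

theorem tri_smul {R : Type*} [Ring R] [Algebra ℂ R] (r : ℂ) (a b d : R) :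
    r • tri a b d = tri (r • a) (r • b) (r • d) := by
  simp [tri]

theorem tri_sub {R : Type*} [Ring R] (a b d a' b' d' : R) :
    tri a b d - tri a' b' d' = tri (a - a') (b - b') (d - d') := by
  simp [tri]

theorem tri_const {R : Type*} [Ring R] [Algebra ℂ R] (r : ℂ) :
    algebraMap ℂ (Matrix (Fin 2) (Fin 2) R) r = tri (algebraMap ℂ R r) 0 (algebraMap ℂ R r) := by
  ext i j
  fin_cases i <;> fin_cases j <;> simp [tri, Matrix.algebraMap_matrix_apply]

theorem tri_congr {R : Type*} [Ring R] {a b d a' b' d' : R} (h₁ : a = a') (h₂ : b = b')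
    (h₃ : d = d') : tri a b d = tri a' b' d' := by
  rw [h₁, h₂, h₃]

/-- The matrix `(B(s), a(s); 0, A(s))` for a generator `a` of `U_q sl₂` and `s = t_{ij}`, where the
comultiplication is `Δ(a) = a ⊗ A + B ⊗ a`. For `a = H`, `A = B = 1`. For `a = X^±`,
`A = e^{hH/4}` and `B = e^{-hH/4}`; the number `b = q^{1/2} = e^{-h/4}` is the
eigenvalue of `B` on `t_{i1}`.
The action on the generators is
`H t_{i1} = t_{i1}`, `H t_{i2} = -t_{i2}`, `X⁺ t_{i1} = 0`, `X⁺ t_{i2} = t_{i1}`,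
`X⁻ t_{i1} = t_{i2}`, `X⁻ t_{i2} = 0`. -/
def actMat {R : Type*} [Ring R] [Algebra ℂ R] (b : ℂ) (s : Fin 2 → Fin 2 → R) :
    UGen → Fin 2 × Fin 2 → Matrix (Fin 2) (Fin 2) R
  | .H, (i, 0) => tri (s i 0) (s i 0) (s i 0)
  | .H, (i, 1) => tri (s i 1) (-s i 1) (s i 1)
  | .Xp, (i, 0) => tri (b • s i 0) 0 (b⁻¹ • s i 0)
  | .Xp, (i, 1) => tri (b⁻¹ • s i 1) (s i 0) (b • s i 1)
  | .Xm, (i, 0) => tri (b • s i 0) (s i 1) (b⁻¹ • s i 0)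
  | .Xm, (i, 1) => tri (b⁻¹ • s i 1) 0 (b • s i 1)

theorem actMat_rel {R : Type*} [Ring R] [Algebra ℂ R] {h k : ℂ} (h0 : h ≠ 0)
    (s : Fin 2 → Fin 2 → R) (u : UGen)
    (r1 : s 0 0 * s 0 1 = (h * h) • (s 0 1 * s 0 0))
    (r2 : s 1 0 * s 1 1 = (h * h) • (s 1 1 * s 1 0))
    (r3 : s 0 0 * s 1 0 = (h * h) • (s 1 0 * s 0 0))
    (r4 : s 0 1 * s 1 1 = (h * h) • (s 1 1 * s 0 1))
    (r5 : s 0 1 * s 1 0 = s 1 0 * s 0 1)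
    (r6 : s 0 0 * s 1 1 - s 1 1 * s 0 0 = ((h * h) - (h * h)⁻¹) • (s 0 1 * s 1 0))
    (r7 : s 0 0 * s 1 1 - (h * h) • (s 0 1 * s 1 0) = algebraMap ℂ R k) :
    actMat h s u (0, 0) * actMat h s u (0, 1) =
      (h * h) • (actMat h s u (0, 1) * actMat h s u (0, 0)) ∧
    actMat h s u (1, 0) * actMat h s u (1, 1) =
      (h * h) • (actMat h s u (1, 1) * actMat h s u (1, 0)) ∧
    actMat h s u (0, 0) * actMat h s u (1, 0) =
      (h * h) • (actMat h s u (1, 0) * actMat h s u (0, 0)) ∧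
    actMat h s u (0, 1) * actMat h s u (1, 1) =
      (h * h) • (actMat h s u (1, 1) * actMat h s u (0, 1)) ∧
    actMat h s u (0, 1) * actMat h s u (1, 0) = actMat h s u (1, 0) * actMat h s u (0, 1) ∧
    actMat h s u (0, 0) * actMat h s u (1, 1) - actMat h s u (1, 1) * actMat h s u (0, 0) =
      ((h * h) - (h * h)⁻¹) • (actMat h s u (0, 1) * actMat h s u (1, 0)) ∧
    actMat h s u (0, 0) * actMat h s u (1, 1) -
      (h * h) • (actMat h s u (0, 1) * actMat h s u (1, 0)) = algebraMap ℂ _ k := by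
  have r7' : s 0 0 * s 1 1 = (h * h) • (s 1 0 * s 0 1) + algebraMap ℂ R k := by
    rw [← r7, ← r5]; abel
  have r6' : s 1 1 * s 0 0 = (h * h)⁻¹ • (s 1 0 * s 0 1) + algebraMap ℂ R k := by
    have e : s 1 1 * s 0 0 = s 0 0 * s 1 1 - ((h * h) - (h * h)⁻¹) • (s 0 1 * s 1 0) := by
      rw [← r6]; abel
    rw [e, r7', r5]; module
  generalize hK : algebraMap ℂ R k = K at *
  refine ⟨?_, ?_, ?_, ?_, ?_, ?_, ?_⟩ <;> cases u <;>
    simp only [actMat, tri_mul, tri_smul, tri_sub, tri_const, hK] <;>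
    refine tri_congr ?_ ?_ ?_ <;>
    simp only [mul_zero, zero_mul, zero_add, smul_mul_assoc, mul_smul_comm, mul_neg,
      neg_mul, r1, r2, r3, r4, r5, r6', r7'] <;>
    match_scalars <;> (try field_simp) <;> try ring

theorem pol_rel (q : Par) (Y : QSpace) :
    t q Y 0 0 * t q Y 0 1 = qc q • (t q Y 0 1 * t q Y 0 0) ∧
    t q Y 1 0 * t q Y 1 1 = qc q • (t q Y 1 1 * t q Y 1 0) ∧
    t q Y 0 0 * t q Y 1 0 = qc q • (t q Y 1 0 * t q Y 0 0) ∧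
    t q Y 0 1 * t q Y 1 1 = qc q • (t q Y 1 1 * t q Y 0 1) ∧
    t q Y 0 1 * t q Y 1 0 = t q Y 1 0 * t q Y 0 1 ∧
    t q Y 0 0 * t q Y 1 1 - t q Y 1 1 * t q Y 0 0 =
      (qc q - (qc q)⁻¹) • (t q Y 0 1 * t q Y 1 0) ∧
    t q Y 0 0 * t q Y 1 1 - qc q • (t q Y 0 1 * t q Y 1 0) = algebraMap ℂ (Pol q Y) Y.c := by
  refine ⟨?_, ?_, ?_, ?_, ?_, ?_, ?_⟩ <;>
    simp only [t, ← map_mul, ← map_smul, ← map_sub]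
  · exact RingQuot.mkAlgHom_rel ℂ .r1112
  · exact RingQuot.mkAlgHom_rel ℂ .r2122
  · exact RingQuot.mkAlgHom_rel ℂ .r1121
  · exact RingQuot.mkAlgHom_rel ℂ .r1222
  · exact RingQuot.mkAlgHom_rel ℂ .r1221
  · exact RingQuot.mkAlgHom_rel ℂ .r1122
  · rw [RingQuot.mkAlgHom_rel ℂ .rdet, AlgHom.commutes]

theorem act_rel (q : Par) (Y : QSpace) (u : UGen) ⦃a b : Free⦄ (h : Rel q Y a b) :
    FreeAlgebra.lift ℂ (actMat (qh q) (t q Y) u) a =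
      FreeAlgebra.lift ℂ (actMat (qh q) (t q Y) u) b := by
  obtain ⟨r1, r2, r3, r4, r5, r6, r7⟩ := pol_rel q Y
  rw [← qh_mul_self q] at r1 r2 r3 r4 r6 r7
  obtain ⟨s1, s2, s3, s4, s5, s6, s7⟩ :=
    actMat_rel (qh_ne_zero q) (t q Y) u r1 r2 r3 r4 r5 r6 r7
  cases h <;>
    simp only [map_mul, map_smul, map_sub, AlgHom.commutes, FreeAlgebra.lift_ι_apply,
      ← qh_mul_self q]
  · exact s1
  · exact s2
  · exact s3
  · exact s4
  · exact s5
  · exact s6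
  · exact s7

/-- The homomorphism `f ↦ (B(f), a(f); 0, A(f))`. -/
def actHom (q : Par) (Y : QSpace) (u : UGen) : Pol q Y →ₐ[ℂ] Matrix (Fin 2) (Fin 2) (Pol q Y) :=
  RingQuot.liftAlgHom ℂ ⟨FreeAlgebra.lift ℂ (actMat (qh q) (t q Y) u), act_rel q Y u⟩

theorem actHom_t (q : Par) (Y : QSpace) (u : UGen) (i j : Fin 2) :
    actHom q Y u (t q Y i j) = actMat (qh q) (t q Y) u (i, j) := by
  simp [actHom, t]

/-- The entries of `actHom` as linear operators. -/
def actEntry (q : Par) (Y : QSpace) (u : UGen) (i j : Fin 2) : Pol q Y →ₗ[ℂ] Pol q Y :=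
  Matrix.entryLinearMap ℂ (Pol q Y) i j ∘ₗ (actHom q Y u).toLinearMap

/-- The action `f ↦ a f` of a generator `a` on `Pol(Y)_q`. -/
def act (q : Par) (Y : QSpace) (u : UGen) : Pol q Y →ₗ[ℂ] Pol q Y := actEntry q Y u 0 1

/-- The operator `A`, where `Δ(a) = a ⊗ A + B ⊗ a`. -/
def actA (q : Par) (Y : QSpace) (u : UGen) : Pol q Y →ₗ[ℂ] Pol q Y := actEntry q Y u 1 1

/-- The operator `B`, where `Δ(a) = a ⊗ A + B ⊗ a`. -/
def actB (q : Par) (Y : QSpace) (u : UGen) : Pol q Y →ₗ[ℂ] Pol q Y := actEntry q Y u 0 0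

/-- `Pol(Y)_q` is a module algebra: `a(f₁ f₂) = a(f₁) A(f₂) + B(f₁) a(f₂)`. -/
theorem act_mul (q : Par) (Y : QSpace) (u : UGen) (f₁ f₂ : Pol q Y) :
    act q Y u (f₁ * f₂) = act q Y u f₁ * actA q Y u f₂ + actB q Y u f₁ * act q Y u f₂ := by
  simp only [act, actA, actB, actEntry, LinearMap.comp_apply, AlgHom.toLinearMap_apply, map_mul,
    Matrix.entryLinearMap_apply, Matrix.mul_apply, Fin.sum_univ_two]
  exact add_comm _ _

/-- A linear operator on `Pol(Y)_q`, regarded on the opposite algebra. -/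
def opMap {q : Par} {Y : QSpace} (φ : Pol q Y →ₗ[ℂ] Pol q Y) :
    (Pol q Y)ᵐᵒᵖ →ₗ[ℂ] (Pol q Y)ᵐᵒᵖ :=
  (MulOpposite.opLinearEquiv ℂ).toLinearMap ∘ₗ φ ∘ₗ (MulOpposite.opLinearEquiv ℂ).symm.toLinearMap

/-- The action of a generator on `Pol(Y₁ × Y₂)_q`:
`a(f₁ ⊗ f₂) = a(f₁) ⊗ A(f₂) + B(f₁) ⊗ a(f₂)`. -/
def act₂ (q : Par) (Y₁ Y₂ : QSpace) (u : UGen) : Pol₂ q Y₁ Y₂ →ₗ[ℂ] Pol₂ q Y₁ Y₂ :=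
  TensorProduct.map (opMap (act q Y₁ u)) (actA q Y₂ u) +
    TensorProduct.map (opMap (actB q Y₁ u)) (act q Y₂ u)

/-- `K` is invariant: every generator `a` of `U_q sl₂`, its action being extended from
`Pol(Y₁ × Y₂)_q` to `D(Y₁ × Y₂)_q'` by continuity, satisfies `a K = ε(a) K = 0`. The extension `T` is
unique, since polynomials are dense. -/
def IsInvariant (q : Par) {Y₁ Y₂ : QSpace} (K : Dist₂ Y₁ Y₂) : Prop :=
  ∀ u : UGen, ∃ T : Dist₂ Y₁ Y₂ →L[ℂ] Dist₂ Y₁ Y₂,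
    (∀ p : Pol₂ q Y₁ Y₂, T (toDist q Y₁ Y₂ p) = toDist q Y₁ Y₂ (act₂ q Y₁ Y₂ u p)) ∧ T K = 0

/-- A function of a nonzero complex variable `λ` with values in `D(Y₁ × Y₂)_q'` is polynomial if its
pairing with every finite function is a Laurent polynomial in `λ`. -/
def IsPolynomial (q : Par) {Y₁ Y₂ : QSpace} (f : ℂˣ → Dist₂ Y₁ Y₂) : Prop :=
  ∀ φ : Fin₂ Y₁ Y₂, ∃ P : LaurentPolynomial ℂ, ∀ z : ℂˣ,
    pair q (f z) φ = LaurentPolynomial.eval₂ (RingHom.id ℂ) z P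

/-- The point `q` of the punctured complex plane. -/
def qUnit (q : Par) : ℂˣ := Units.mk0 (qc q) (qc_ne_zero q)

/-- `f` interpolates the kernels: `f(q^{2l}) = k₂₂^l k₁₁^l` for all integers `l ≥ 0`. -/
def Interpolates (q : Par) {Y₁ Y₂ : QSpace} (f : ℂˣ → Dist₂ Y₁ Y₂) : Prop :=
  ∀ l : ℕ, f (qUnit q ^ (2 * l)) = toDist q Y₁ Y₂ (k22 q Y₁ Y₂ ^ l * k11 q Y₁ Y₂ ^ l)

end QKernel

end

namespace QKernel

/-! ### Matrix elements of polynomials -/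

/-! In the realization on `V` every generator is a weighted shift, and each coefficient of a series
is, up to a nonzero factor, a single matrix element. Distributions are thus studied through matrix
elements, and a statement about kernels becomes one about scalar functions of `l`.

Existence: on matrix elements, right multiplication by `k₁₁` or `k₂₂` is a sum of two weighted
shifts that commute up to the factor `q²`, resp. `q⁻²`. The `q`-binomial theorem (`twoTerm_iterate`)
turns a matrix element of `k₂₂^l k₁₁^l` into a double sum over `a, b ≤ l` (`matEl₂_kernel`). The
displacements depending on `l` cancel between the two kernels, and each summand is a Laurent
polynomial in `x = q^{2l}`. It remains to bound the number of summands independently of `l`. The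
difference `a - b` is fixed by the matrix element, and large `a` is excluded by a vanishing factor
`1 - q^{-2m}` at `m = 0`, available as soon as one of the two spaces is `X̃` (`kernelTerm_eq_zero`).
The truncated sum `kernelEl` makes sense for every nonzero `x` and defines the interpolating kernel.

Uniqueness: pairing with a suitable finite function isolates one coefficient (`pair_partner`), so
all coefficients of a polynomial function are Laurent polynomials, and these are determined by their
values at the infinitely many points `q^{2l}`.

Invariance: the kernels `k₂₂^l k₁₁^l` are invariant. The action of `U_q sl₂` extends continuously to
distributions because its generators act in `V` by twisted commutators (`rho_act`). A continuous
functional involves finitely many coefficients, so each coefficient of the result of applying a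
generator to `f(x)` is a Laurent polynomial in `x` vanishing at all `q^{2l}`, hence zero. -/

theorem Pol.induction {q : Par} {Y : QSpace} {C : Pol q Y → Prop}
    (algebraMap : ∀ r, C (algebraMap ℂ (Pol q Y) r)) (gen : ∀ i j, C (t q Y i j))
    (mul : ∀ a b, C a → C b → C (a * b)) (add : ∀ a b, C a → C b → C (a + b)) (f : Pol q Y) :
    C f := by
  obtain ⟨a, rfl⟩ := RingQuot.mkAlgHom_surjective ℂ (Rel q Y) f
  induction a using FreeAlgebra.induction with
  | grade0 r => simpa using algebraMap r
  | grade1 x => exact gen x.1 x.2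
  | mul a b ha hb => rw [map_mul]; exact mul _ _ ha hb
  | add a b ha hb => rw [map_add]; exact add _ _ ha hb

/-- The weighted shift `|p⟩ ↦ w(p) |p + d⟩`. -/
noncomputable def gshift (d : ℤ × ℤ) (w : ℤ × ℤ → ℂ) : Module.End ℂ V :=
  Finsupp.linearCombination ℂ (fun p : ℤ × ℤ => Finsupp.single (p + d) (w p))

theorem gshift_single (d : ℤ × ℤ) (w : ℤ × ℤ → ℂ) (p : ℤ × ℤ) (a : ℂ) :
    gshift d w (Finsupp.single p a) = Finsupp.single (p + d) (a * w p) := by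
  simp [gshift]

/-- The generators have weights depending on `m` alone. Weights in both coordinates are needed for
the operators that implement `U_q sl₂`. -/
theorem wshift_eq_gshift (d : ℤ × ℤ) (w : ℤ → ℂ) : wshift d w = gshift d (fun p => w p.1) := rfl

theorem gshift_apply (d : ℤ × ℤ) (w : ℤ × ℤ → ℂ) (v : V) (p : ℤ × ℤ) :
    gshift d w v p = w (p - d) * v (p - d) := by
  induction v using Finsupp.induction_linear with
  | zero => simp
  | add f g hf hg => simp [hf, hg, mul_add]
  | single r a =>
    rw [gshift_single]
    by_cases h : r = p - d
    · subst h; simp [mul_comm]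
    · rw [Finsupp.single_eq_of_ne, Finsupp.single_eq_of_ne, mul_zero]
      · exact fun h' => h h'.symm
      · rintro rfl; simp at h

theorem gshift_mul (d e : ℤ × ℤ) (w v : ℤ × ℤ → ℂ) :
    gshift d w * gshift e v = gshift (d + e) (fun p => v p * w (p + e)) := by
  refine Finsupp.lhom_ext fun p a => ?_
  rw [Module.End.mul_apply, gshift_single, gshift_single, gshift_single, add_assoc, add_comm e d,
    mul_assoc]

theorem gshift_smul (r : ℂ) (d : ℤ × ℤ) (w : ℤ × ℤ → ℂ) :
    r • gshift d w = gshift d (fun p => r * w p) := by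
  refine Finsupp.lhom_ext fun p a => ?_
  rw [LinearMap.smul_apply, gshift_single, gshift_single, Finsupp.smul_single, smul_eq_mul]
  congr 1
  ring

theorem gshift_add (d : ℤ × ℤ) (w v : ℤ × ℤ → ℂ) :
    gshift d w + gshift d v = gshift d (fun p => w p + v p) := by
  refine Finsupp.lhom_ext fun p a => ?_
  rw [LinearMap.add_apply, gshift_single, gshift_single, gshift_single, ← Finsupp.single_add,
    mul_add]

theorem gshift_neg (d : ℤ × ℤ) (w : ℤ × ℤ → ℂ) : -gshift d w = gshift d (fun p => -w p) := by
  refine Finsupp.lhom_ext fun p a => ?_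
  rw [LinearMap.neg_apply, gshift_single, gshift_single, ← Finsupp.single_neg, mul_neg]

/-- The matrix element `⟨p'| f |p⟩`. -/
noncomputable def matEl (q : Par) (Y : QSpace) (p p' : ℤ × ℤ) : Pol q Y →ₗ[ℂ] ℂ :=
  Finsupp.lapply p' ∘ₗ LinearMap.applyₗ (Finsupp.single p (1 : ℂ)) ∘ₗ (rho q Y).toLinearMap

theorem matEl_apply (q : Par) (Y : QSpace) (p p' : ℤ × ℤ) (f : Pol q Y) :
    matEl q Y p p' f = rho q Y f (Finsupp.single p 1) p' := rfl

theorem apply_single (T : Module.End ℂ V) (p p' : ℤ × ℤ) (a : ℂ) :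
    T (Finsupp.single p a) p' = a * T (Finsupp.single p 1) p' := by
  rw [← Finsupp.smul_single_one p a, map_smul, Finsupp.smul_apply, smul_eq_mul]

theorem matEl_one (q : Par) (Y : QSpace) (p p' : ℤ × ℤ) :
    matEl q Y p p' 1 = if p = p' then 1 else 0 := by
  rw [matEl_apply, map_one, Module.End.one_apply, Finsupp.single_apply]

theorem matEl_shift_mul (q : Par) (Y : QSpace) (p p' d : ℤ × ℤ) (w : ℤ → ℂ) (f g : Pol q Y)
    (hf : rho q Y f = wshift d w) :
    matEl q Y p p' (f * g) = w (p' - d).1 * matEl q Y p (p' - d) g := by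
  rw [matEl_apply, map_mul, hf, Module.End.mul_apply, wshift_eq_gshift, gshift_apply]
  rfl

theorem matEl_mul_shift (q : Par) (Y : QSpace) (p p' d : ℤ × ℤ) (w : ℤ → ℂ) (f g : Pol q Y)
    (hf : rho q Y f = wshift d w) :
    matEl q Y p p' (g * f) = w p.1 * matEl q Y (p + d) p' g := by
  rw [matEl_apply, map_mul, hf, Module.End.mul_apply, wshift_single, one_mul,
    apply_single, matEl_apply]

/-- No weight of a generator depends on `n`. -/
theorem rho_commute_translation (q : Par) (Y : QSpace) (n : ℤ) (f : Pol q Y) :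
    rho q Y f * gshift (0, n) (fun _ => 1) = gshift (0, n) (fun _ => 1) * rho q Y f := by
  induction f using Pol.induction with
  | algebraMap r => rw [AlgHom.commutes]; exact Algebra.commutes _ _
  | gen i j =>
    rw [rho_t]
    fin_cases i <;> fin_cases j <;>
      simp only [rhoGen, wshift_eq_gshift, gshift_mul] <;> congr 1 <;>
      ext <;> simp [add_comm]
  | mul a b ha hb => rw [map_mul, mul_assoc, hb, ← mul_assoc, ha, mul_assoc]
  | add a b ha hb => rw [map_add, add_mul, ha, hb, mul_add]

theorem matEl_translate (q : Par) (Y : QSpace) (p p' : ℤ × ℤ) (n : ℤ) (f : Pol q Y) :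
    matEl q Y (p + (0, n)) (p' + (0, n)) f = matEl q Y p p' f := by
  have h := congrArg (fun T => T (Finsupp.single p 1) (p' + (0, n)))
    (rho_commute_translation q Y n f)
  simpa [gshift_single, gshift_apply, ← matEl_apply] using h

/-- For `X̃` the span of the vectors with `m ≥ 0` is invariant under the whole algebra. -/
theorem matEl_eq_zero (q : Par) (p p' : ℤ × ℤ) (hp : 0 ≤ p.1) (hp' : p'.1 < 0)
    (f : Pol q .X) : matEl q .X p p' f = 0 := by
  have key : ∀ v : V, (∀ r : ℤ × ℤ, r.1 < 0 → v r = 0) →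
      ∀ r : ℤ × ℤ, r.1 < 0 → rho q .X f v r = 0 := by
    induction f using Pol.induction with
    | algebraMap c =>
      intro v hv r hr
      simp [Module.algebraMap_end_apply, hv r hr]
    | gen i j =>
      intro v hv r hr
      rw [rho_t]
      fin_cases i <;> fin_cases j <;> simp only [rhoGen, wshift_eq_gshift, gshift_apply]
      · rw [hv _ (by simp; omega), mul_zero]
      · rw [hv _ (by simpa using hr), mul_zero]
      · rw [hv _ (by simpa using hr), mul_zero]
      -- Only `t₂₂` lowers `m`, and for `c = 1` its weight `-(q^{-2m} - 1)` vanishes at `m = 0`.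
      · by_cases h : r.1 = -1
        · simp [h, QSpace.c]
        · rw [hv _ (by simp; omega), mul_zero]
    | mul a b ha hb =>
      intro v hv r hr
      rw [map_mul, Module.End.mul_apply]
      exact ha _ (fun s hs => hb v hv s hs) r hr
    | add a b ha hb =>
      intro v hv r hr
      rw [map_add, LinearMap.add_apply, Finsupp.add_apply, ha v hv r hr, hb v hv r hr, add_zero]
  rw [matEl_apply]
  refine key _ (fun r hr => ?_) p' hp'
  rw [Finsupp.single_eq_of_ne]
  rintro rfl
  omega

theorem polCoeff_eq (q : Par) {Y : QSpace} (α : Idx Y) :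
    polCoeff q α = (entry α (finOp q α))⁻¹ •
      matEl q Y (α.m + α.j₁, 0) (α.m + α.i₁, (α.i₂ : ℤ) - α.j₂) := rfl

theorem matEl_eq_smul_polCoeff (q : Par) {Y : QSpace} (α : Idx Y) :
    matEl q Y (α.m + α.j₁, 0) (α.m + α.i₁, (α.i₂ : ℤ) - α.j₂) =
      entry α (finOp q α) • polCoeff q α := by
  rw [polCoeff_eq, smul_smul, mul_inv_cancel₀ (entry_finOp_ne_zero q α), one_smul]

/-- The functionals on `Pol(Y)_q` continuous in the topology of `D(Y)_q'`. -/
noncomputable def coeffSpan (q : Par) (Y : QSpace) : Submodule ℂ (Pol q Y →ₗ[ℂ] ℂ) :=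
  Submodule.span ℂ (Set.range fun α : Idx Y => polCoeff q α)

/-- Up to a translation in `n`, every matrix element starting in the admissible range is one of
those that define coefficients, or zero. -/
theorem matEl_mem (q : Par) (Y : QSpace) (p p' : ℤ × ℤ) (hp : Y = .X → 0 ≤ p.1) :
    matEl q Y p p' ∈ coeffSpan q Y := by
  by_cases h : Y = .X ∧ p'.1 < 0
  · obtain ⟨rfl, h⟩ := h
    rw [show matEl q .X p p' = 0 from LinearMap.ext fun f => matEl_eq_zero q p p' (hp rfl) h f]
    exact zero_mem _
  · rw [not_and, not_lt] at h
    -- The exponents are the positive and negative parts of `p' - p`, so in each pair one exponent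
    -- vanishes. The lower of the two levels `m` is the argument of `ψ`.
    let α : Idx Y := ⟨(p'.1 - min p.1 p'.1).toNat, (p'.2 - p.2).toNat, (p.1 - min p.1 p'.1).toNat,
      (p.2 - p'.2).toNat, min p.1 p'.1, by rw [Nat.mul_eq_zero]; omega,
      by rw [Nat.mul_eq_zero]; omega, fun e => le_min (hp e) (h e)⟩
    have e : matEl q Y p p' = matEl q Y (α.m + α.j₁, 0) (α.m + α.i₁, (α.i₂ : ℤ) - α.j₂) := by
      refine LinearMap.ext fun f => ?_
      rw [← matEl_translate q Y (α.m + α.j₁, 0) _ p.2]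
      congr 1
      congr 1 <;> (ext <;> simp [α] <;> omega)
    rw [e, matEl_eq_smul_polCoeff]
    exact Submodule.smul_mem _ _ (Submodule.subset_span ⟨α, rfl⟩)

/-! ### The action of `U_q sl₂` in the realization -/

theorem actHom_lower (q : Par) (Y : QSpace) (u : UGen) (f : Pol q Y) : actHom q Y u f 1 0 = 0 := by
  induction f using Pol.induction with
  | algebraMap r => rw [AlgHom.commutes, tri_const]; simp [tri]
  | gen i j => rw [actHom_t]; cases u <;> fin_cases j <;> simp [actMat, tri]
  | mul a b ha hb => simp [map_mul, Matrix.mul_apply, ha, hb]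
  | add a b ha hb => simp [ha, hb]

theorem actA_mul (q : Par) (Y : QSpace) (u : UGen) (f g : Pol q Y) :
    actA q Y u (f * g) = actA q Y u f * actA q Y u g := by
  simp [actA, actEntry, Matrix.mul_apply, actHom_lower]

theorem actB_mul (q : Par) (Y : QSpace) (u : UGen) (f g : Pol q Y) :
    actB q Y u (f * g) = actB q Y u f * actB q Y u g := by
  simp [actB, actEntry, Matrix.mul_apply, actHom_lower]

theorem actA_algebraMap (q : Par) (Y : QSpace) (u : UGen) (r : ℂ) :
    actA q Y u (algebraMap ℂ _ r) = algebraMap ℂ _ r := by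
  simp [actA, actEntry, Matrix.algebraMap_matrix_apply]

theorem actB_algebraMap (q : Par) (Y : QSpace) (u : UGen) (r : ℂ) :
    actB q Y u (algebraMap ℂ _ r) = algebraMap ℂ _ r := by
  simp [actB, actEntry, Matrix.algebraMap_matrix_apply]

theorem act_algebraMap (q : Par) (Y : QSpace) (u : UGen) (r : ℂ) :
    act q Y u (algebraMap ℂ _ r) = 0 := by
  simp [act, actEntry, Matrix.algebraMap_matrix_apply]

theorem act_t (q : Par) (Y : QSpace) (u : UGen) (i j : Fin 2) :
    act q Y u (t q Y i j) = actMat (qh q) (t q Y) u (i, j) 0 1 := by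
  rw [← actHom_t]; rfl

theorem actA_t (q : Par) (Y : QSpace) (u : UGen) (i j : Fin 2) :
    actA q Y u (t q Y i j) = actMat (qh q) (t q Y) u (i, j) 1 1 := by
  rw [← actHom_t]; rfl

theorem actB_t (q : Par) (Y : QSpace) (u : UGen) (i j : Fin 2) :
    actB q Y u (t q Y i j) = actMat (qh q) (t q Y) u (i, j) 0 0 := by
  rw [← actHom_t]; rfl

/-- The eigenvalue of the group-like element `B` on operators of degree `d`. -/
noncomputable def chi (q : Par) : UGen → ℤ × ℤ → ℂ
  | .H, _ => 1
  | _, d => qh q ^ (d.1 - d.2)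

theorem chi_ne_zero (q : Par) (u : UGen) (d : ℤ × ℤ) : chi q u d ≠ 0 := by
  cases u
  · exact one_ne_zero
  all_goals exact zpow_ne_zero _ (qh_ne_zero q)

/-- The degree of an operator implementing the action of a generator of `U_q sl₂`. -/
def actDeg : UGen → ℤ × ℤ
  | .H => 0
  | .Xp => (1, -1)
  | .Xm => (-1, 1)

/-- The weight of an operator implementing the action of a generator of `U_q sl₂`. -/
noncomputable def actWeight (q : Par) (Y : QSpace) : UGen → ℤ × ℤ → ℂ
  | .H, p => p.1 - p.2
  | .Xp, p => qh q / (qh q ^ 4 - 1) * qc q ^ (p.1 + 1)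
  | .Xm, p => -(qh q ^ 3 / (qh q ^ 4 - 1)) * (qc q ^ p.1 * (qc q ^ (-2 * p.1) - Y.c))

theorem qh_pow_four_ne_one (q : Par) : qh q ^ 4 ≠ 1 := by
  have h : qh q ^ 4 = qc q ^ 2 := by rw [← qh_mul_self]; ring
  rw [h, qc]
  have h1 : (q : ℝ) ^ 2 < 1 := pow_lt_one₀ q.2.1.le q.2.2 two_ne_zero
  exact_mod_cast h1.ne

/-- The automorphisms `A` and `B` are conjugations by the diagonal operators with entries `chi⁻¹`
and `chi`. It suffices to check generators, both sides being multiplicative. -/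
theorem rho_actA (q : Par) (Y : QSpace) (u : UGen) (f : Pol q Y) :
    rho q Y (actA q Y u f) * gshift 0 (fun p => (chi q u p)⁻¹) =
      gshift 0 (fun p => (chi q u p)⁻¹) * rho q Y f := by
  have hb := qh_ne_zero q
  induction f using Pol.induction with
  | algebraMap r => rw [actA_algebraMap, AlgHom.commutes]; exact Algebra.commutes _ _
  | gen i j =>
    rw [actA_t]
    cases u <;> fin_cases i <;> fin_cases j <;>
      simp [actMat, tri, rho_t, rhoGen, wshift_eq_gshift, gshift_mul, gshift_smul, chi] <;>
      congr 1 <;> funext p <;> simp [zpow_sub₀ hb, zpow_add₀ hb] <;> field_simp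
  | mul a b ha hb => rw [actA_mul, map_mul, map_mul, mul_assoc, hb, ← mul_assoc, ha, mul_assoc]
  | add a b ha hb => rw [map_add, map_add, map_add, add_mul, ha, hb, mul_add]

theorem rho_actB (q : Par) (Y : QSpace) (u : UGen) (f : Pol q Y) :
    rho q Y (actB q Y u f) * gshift 0 (chi q u) = gshift 0 (chi q u) * rho q Y f := by
  have hb := qh_ne_zero q
  induction f using Pol.induction with
  | algebraMap r => rw [actB_algebraMap, AlgHom.commutes]; exact Algebra.commutes _ _
  | gen i j =>
    rw [actB_t]
    cases u <;> fin_cases i <;> fin_cases j <;>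
      simp [actMat, tri, rho_t, rhoGen, wshift_eq_gshift, gshift_mul, gshift_smul, chi] <;>
      congr 1 <;> funext p <;> simp [zpow_sub₀ hb, zpow_add₀ hb] <;> field_simp
  | mul a b ha hb => rw [actB_mul, map_mul, map_mul, mul_assoc, hb, ← mul_assoc, ha, mul_assoc]
  | add a b ha hb => rw [map_add, map_add, map_add, add_mul, ha, hb, mul_add]

theorem matEl_actA (q : Par) (Y : QSpace) (u : UGen) (p p' : ℤ × ℤ) (f : Pol q Y) :
    matEl q Y p p' (actA q Y u f) = chi q u p * (chi q u p')⁻¹ * matEl q Y p p' f := by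
  have h := congrArg (fun T => T (Finsupp.single p (chi q u p)) p') (rho_actA q Y u f)
  simp only [Module.End.mul_apply, gshift_single, gshift_apply, sub_zero, add_zero,
    mul_inv_cancel₀ (chi_ne_zero q u p)] at h
  rw [matEl_apply, h, apply_single, matEl_apply]
  ring

theorem matEl_actB (q : Par) (Y : QSpace) (u : UGen) (p p' : ℤ × ℤ) (f : Pol q Y) :
    matEl q Y p p' (actB q Y u f) = (chi q u p)⁻¹ * chi q u p' * matEl q Y p p' f := by
  have h := congrArg (fun T => T (Finsupp.single p (chi q u p)⁻¹) p') (rho_actB q Y u f)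
  simp only [Module.End.mul_apply, gshift_single, gshift_apply, sub_zero, add_zero,
    inv_mul_cancel₀ (chi_ne_zero q u p)] at h
  rw [matEl_apply, h, apply_single, matEl_apply]
  ring

/-- With `W` the shift of weight `actWeight`, the action is the twisted commutator `f ↦ W A(f) -
B(f) W`. Every such commutator satisfies the same twisted Leibniz rule as the action, so only the
generators of `Pol(Y)_q` need checking; they dictate the constants in `actWeight`. -/
theorem rho_act (q : Par) (Y : QSpace) (u : UGen) (f : Pol q Y) :
    rho q Y (act q Y u f) + rho q Y (actB q Y u f) * gshift (actDeg u) (actWeight q Y u) =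
      gshift (actDeg u) (actWeight q Y u) * rho q Y (actA q Y u f) := by
  have hb := qh_ne_zero q
  have hq := qc_ne_zero q
  have h1 : qh q ^ 4 - 1 ≠ 0 := sub_ne_zero.2 (qh_pow_four_ne_one q)
  induction f using Pol.induction with
  | algebraMap r =>
    rw [act_algebraMap, actA_algebraMap, actB_algebraMap, AlgHom.commutes, map_zero,
      Algebra.commutes, zero_add]
  | gen i j =>
    rw [act_t, actA_t, actB_t]
    cases u <;> fin_cases i <;> fin_cases j <;>
      simp [actMat, tri, rho_t, rhoGen, wshift_eq_gshift, gshift_mul, gshift_smul, gshift_add,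
        actDeg, actWeight]
    all_goals
      try simp only [gshift_neg, gshift_add]
      congr 1
      funext p
      have hZ : qc q ^ p.1 ≠ 0 := zpow_ne_zero _ hq
      try simp only [mul_add, zpow_add₀ hq, two_mul, zpow_one, zpow_neg_one, mul_neg, mul_one]
      generalize qc q ^ p.1 = Z at *
      try rw [← qh_mul_self]
      field_simp
      try ring
  | mul a b ha hb =>
    rw [act_mul, actA_mul, actB_mul]
    simp only [map_mul, map_add]
    rw [← mul_assoc, ← ha, add_mul, mul_assoc (rho q Y (actB q Y u a)) (gshift _ _), ← hb, mul_add,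
      add_assoc, mul_assoc]
  | add a b ha hb =>
    simp only [map_add, mul_add, add_mul, ← ha, ← hb]
    abel

theorem matEl_act (q : Par) (Y : QSpace) (u : UGen) (p p' : ℤ × ℤ) (f : Pol q Y) :
    matEl q Y p p' (act q Y u f) =
      actWeight q Y u (p' - actDeg u) * matEl q Y p (p' - actDeg u) (actA q Y u f) -
        actWeight q Y u p * matEl q Y (p + actDeg u) p' (actB q Y u f) := by
  have h := congrArg (fun T => T (Finsupp.single p 1) p') (rho_act q Y u f)
  simp only [Module.End.mul_apply, LinearMap.add_apply, Finsupp.add_apply, gshift_single,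
    gshift_apply, one_mul] at h
  rw [apply_single _ (p + actDeg u)] at h
  exact eq_sub_of_add_eq h

/-- The implementing operators preserve the span of `m ≥ 0` for `X̃`: the weight for `X⁻` contains
`q^{-2m} - c`, zero at `m = 0`. This keeps all matrix elements of the action within the admissible
range. -/
theorem actWeight_eq_zero (q : Par) (Y : QSpace) (u : UGen) (p : ℤ × ℤ)
    (hp : Y = .X → 0 ≤ p.1) (h : ¬(Y = .X → 0 ≤ (p + actDeg u).1)) :
    actWeight q Y u p = 0 := by
  rw [Classical.not_imp] at h
  obtain ⟨rfl, h⟩ := h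
  have h0 := hp rfl
  cases u <;> simp [actDeg] at h
  · omega
  · omega
  · have : p.1 = 0 := by omega
    simp [actWeight, this, QSpace.c]

/-- A linear operator on `Pol(Y)_q` continuous in the topology of `D(Y)_q'`. -/
def IsCoeffContinuous {q : Par} {Y : QSpace} (L : Pol q Y →ₗ[ℂ] Pol q Y) : Prop :=
  ∀ α : Idx Y, polCoeff q α ∘ₗ L ∈ coeffSpan q Y

theorem isCoeffContinuous_of_matEl {q : Par} {Y : QSpace} {L : Pol q Y →ₗ[ℂ] Pol q Y}
    (h : ∀ p p' : ℤ × ℤ, (Y = .X → 0 ≤ p.1) → matEl q Y p p' ∘ₗ L ∈ coeffSpan q Y) :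
    IsCoeffContinuous L := fun α => by
  rw [polCoeff_eq, LinearMap.smul_comp]
  refine Submodule.smul_mem _ _ (h _ _ fun hY => ?_)
  have := α.hm hY
  positivity

theorem matEl_comp_actA_mem (q : Par) (Y : QSpace) (u : UGen) (p p' : ℤ × ℤ)
    (hp : Y = .X → 0 ≤ p.1) : matEl q Y p p' ∘ₗ actA q Y u ∈ coeffSpan q Y := by
  rw [show matEl q Y p p' ∘ₗ actA q Y u = (chi q u p * (chi q u p')⁻¹) • matEl q Y p p' from
    LinearMap.ext fun f => matEl_actA q Y u p p' f]
  exact Submodule.smul_mem _ _ (matEl_mem q Y p p' hp)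

theorem matEl_comp_actB_mem (q : Par) (Y : QSpace) (u : UGen) (p p' : ℤ × ℤ)
    (hp : Y = .X → 0 ≤ p.1) : matEl q Y p p' ∘ₗ actB q Y u ∈ coeffSpan q Y := by
  rw [show matEl q Y p p' ∘ₗ actB q Y u = ((chi q u p)⁻¹ * chi q u p') • matEl q Y p p' from
    LinearMap.ext fun f => matEl_actB q Y u p p' f]
  exact Submodule.smul_mem _ _ (matEl_mem q Y p p' hp)

theorem matEl_comp_act_mem (q : Par) (Y : QSpace) (u : UGen) (p p' : ℤ × ℤ)
    (hp : Y = .X → 0 ≤ p.1) : matEl q Y p p' ∘ₗ act q Y u ∈ coeffSpan q Y := by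
  rw [show matEl q Y p p' ∘ₗ act q Y u =
    actWeight q Y u (p' - actDeg u) • (matEl q Y p (p' - actDeg u) ∘ₗ actA q Y u) -
      actWeight q Y u p • (matEl q Y (p + actDeg u) p' ∘ₗ actB q Y u) from
    LinearMap.ext fun f => matEl_act q Y u p p' f]
  refine Submodule.sub_mem _ (Submodule.smul_mem _ _ (matEl_comp_actA_mem q Y u _ _ hp)) ?_
  by_cases h : Y = .X → 0 ≤ (p + actDeg u).1
  · exact Submodule.smul_mem _ _ (matEl_comp_actB_mem q Y u _ _ h)
  · rw [actWeight_eq_zero q Y u p hp h, zero_smul]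
    exact zero_mem _

theorem isCoeffContinuous_act (q : Par) (Y : QSpace) (u : UGen) :
    IsCoeffContinuous (act q Y u) :=
  isCoeffContinuous_of_matEl (matEl_comp_act_mem q Y u)

theorem isCoeffContinuous_actA (q : Par) (Y : QSpace) (u : UGen) :
    IsCoeffContinuous (actA q Y u) :=
  isCoeffContinuous_of_matEl (matEl_comp_actA_mem q Y u)

theorem isCoeffContinuous_actB (q : Par) (Y : QSpace) (u : UGen) :
    IsCoeffContinuous (actB q Y u) :=
  isCoeffContinuous_of_matEl (matEl_comp_actB_mem q Y u)

/-! ### Extension of operators to distributions by continuity -/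

/-- Each coefficient of the image is a finite combination of coefficients of the argument, and that
same formula makes sense for arbitrary series. -/
theorem exists_continuous_extension (q : Par) {Y₁ Y₂ : QSpace} {L₁ : Pol q Y₁ →ₗ[ℂ] Pol q Y₁}
    {L₂ : Pol q Y₂ →ₗ[ℂ] Pol q Y₂} (h₁ : IsCoeffContinuous L₁) (h₂ : IsCoeffContinuous L₂) :
    ∃ T : Dist₂ Y₁ Y₂ →L[ℂ] Dist₂ Y₁ Y₂, ∀ p : Pol₂ q Y₁ Y₂,
      T (toDist q Y₁ Y₂ p) = toDist q Y₁ Y₂ (TensorProduct.map (opMap L₁) L₂ p) := by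
  choose c hc using fun α => (Finsupp.mem_span_range_iff_exists_finsupp).1 (h₁ α)
  choose d hd using fun α => (Finsupp.mem_span_range_iff_exists_finsupp).1 (h₂ α)
  refine ⟨ContinuousLinearMap.pi fun p => ∑ r ∈ (c p.1).support, ∑ s ∈ (d p.2).support,
    (c p.1 r * d p.2 s) • ContinuousLinearMap.proj (r, s), fun p => ?_⟩
  induction p using TensorProduct.induction_on with
  | zero => simp only [map_zero]
  | add a b ha hb => rw [map_add, map_add, ha, hb, map_add, map_add]
  | tmul a b =>
    funext p
    have ea := congrArg (fun φ => φ a.unop) (hc p.1)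
    have eb := congrArg (fun φ => φ b) (hd p.2)
    simp only [Finsupp.sum, LinearMap.sum_apply, LinearMap.smul_apply, LinearMap.comp_apply,
      smul_eq_mul] at ea eb
    rw [TensorProduct.map_tmul, show opMap L₁ a = MulOpposite.op (L₁ a.unop) from rfl, toDist_tmul,
      ← ea, ← eb, Finset.sum_mul_sum]
    simp only [ContinuousLinearMap.coe_pi', _root_.sum_apply,
      _root_.smul_apply, ContinuousLinearMap.proj_apply, smul_eq_mul]
    refine Finset.sum_congr rfl fun r _ => Finset.sum_congr rfl fun s _ => ?_
    rw [← MulOpposite.op_unop a, toDist_tmul]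
    simp only [MulOpposite.unop_op]
    ring

theorem exists_act₂_extension (q : Par) (Y₁ Y₂ : QSpace) (u : UGen) :
    ∃ T : Dist₂ Y₁ Y₂ →L[ℂ] Dist₂ Y₁ Y₂, ∀ p : Pol₂ q Y₁ Y₂,
      T (toDist q Y₁ Y₂ p) = toDist q Y₁ Y₂ (act₂ q Y₁ Y₂ u p) := by
  obtain ⟨T, hT⟩ := exists_continuous_extension q (isCoeffContinuous_act q Y₁ u)
    (isCoeffContinuous_actA q Y₂ u)
  obtain ⟨S, hS⟩ := exists_continuous_extension q (isCoeffContinuous_actB q Y₁ u)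
    (isCoeffContinuous_act q Y₂ u)
  refine ⟨T + S, fun p => ?_⟩
  rw [_root_.add_apply, hT, hS, act₂, LinearMap.add_apply, map_add]

/-! ### Invariant polynomial kernels -/

/-- `A ⊗ A` on `Pol(Y₁ × Y₂)_q`, where `Δ(a) = a ⊗ A + B ⊗ a`. -/
noncomputable def actAA (q : Par) (Y₁ Y₂ : QSpace) (u : UGen) : Pol₂ q Y₁ Y₂ →ₗ[ℂ] Pol₂ q Y₁ Y₂ :=
  TensorProduct.map (opMap (actA q Y₁ u)) (actA q Y₂ u)

/-- `B ⊗ B` on `Pol(Y₁ × Y₂)_q`, where `Δ(a) = a ⊗ A + B ⊗ a`. -/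
noncomputable def actBB (q : Par) (Y₁ Y₂ : QSpace) (u : UGen) : Pol₂ q Y₁ Y₂ →ₗ[ℂ] Pol₂ q Y₁ Y₂ :=
  TensorProduct.map (opMap (actB q Y₁ u)) (actB q Y₂ u)

theorem opMap_op {q : Par} {Y : QSpace} (φ : Pol q Y →ₗ[ℂ] Pol q Y) (a : Pol q Y) :
    opMap φ (MulOpposite.op a) = MulOpposite.op (φ a) := rfl

theorem Pol₂.induction {q : Par} {Y₁ Y₂ : QSpace} {C : Pol₂ q Y₁ Y₂ → Prop} (zero : C 0)
    (tmul : ∀ a b, C (MulOpposite.op a ⊗ₜ b)) (add : ∀ K L, C K → C L → C (K + L))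
    (K : Pol₂ q Y₁ Y₂) : C K :=
  TensorProduct.induction_on K zero (fun a b => tmul a.unop b) add

theorem actAA_mul (q : Par) (Y₁ Y₂ : QSpace) (u : UGen) (K L : Pol₂ q Y₁ Y₂) :
    actAA q Y₁ Y₂ u (K * L) = actAA q Y₁ Y₂ u K * actAA q Y₁ Y₂ u L := by
  induction K using Pol₂.induction with
  | zero => simp
  | add K K' h h' => rw [add_mul, map_add, map_add, h, h', add_mul]
  | tmul a b =>
    induction L using Pol₂.induction with
    | zero => simp
    | add L L' h h' => rw [mul_add, map_add, map_add, h, h', mul_add]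
    | tmul c d =>
      simp only [actAA, Algebra.TensorProduct.tmul_mul_tmul, TensorProduct.map_tmul, opMap_op,
        ← MulOpposite.op_mul, actA_mul]

theorem actBB_mul (q : Par) (Y₁ Y₂ : QSpace) (u : UGen) (K L : Pol₂ q Y₁ Y₂) :
    actBB q Y₁ Y₂ u (K * L) = actBB q Y₁ Y₂ u K * actBB q Y₁ Y₂ u L := by
  induction K using Pol₂.induction with
  | zero => simp
  | add K K' h h' => rw [add_mul, map_add, map_add, h, h', add_mul]
  | tmul a b =>
    induction L using Pol₂.induction with
    | zero => simp
    | add L L' h h' => rw [mul_add, map_add, map_add, h, h', mul_add]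
    | tmul c d =>
      simp only [actBB, Algebra.TensorProduct.tmul_mul_tmul, TensorProduct.map_tmul, opMap_op,
        ← MulOpposite.op_mul, actB_mul]

/-- Multiplication in the first factor is reversed, so the usual Leibniz rule for a module algebra
fails. The part acting on `L` splits into two terms, preceded by `A ⊗ A` and `B ⊗ B` of `K`
respectively. -/
theorem act₂_mul (q : Par) (Y₁ Y₂ : QSpace) (u : UGen) (K L : Pol₂ q Y₁ Y₂) :
    act₂ q Y₁ Y₂ u (K * L) =
      act₂ q Y₁ Y₂ u K * TensorProduct.map (opMap (actB q Y₁ u)) (actA q Y₂ u) L +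
      (actAA q Y₁ Y₂ u K * TensorProduct.map (opMap (act q Y₁ u)) (actA q Y₂ u) L +
        actBB q Y₁ Y₂ u K * TensorProduct.map (opMap (actB q Y₁ u)) (act q Y₂ u) L) := by
  induction K using Pol₂.induction with
  | zero => simp
  | add K K' h h' =>
    simp only [add_mul, map_add, h, h']
    abel
  | tmul a b =>
    induction L using Pol₂.induction with
    | zero => simp
    | add L L' h h' =>
      simp only [mul_add, map_add, h, h']
      abel
    | tmul c d =>
      simp only [act₂, actAA, actBB, LinearMap.add_apply, Algebra.TensorProduct.tmul_mul_tmul,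
        TensorProduct.map_tmul, opMap_op, ← MulOpposite.op_mul, actA_mul, actB_mul, act_mul,
        MulOpposite.op_add, TensorProduct.add_tmul, TensorProduct.tmul_add, add_mul]
      abel

/-- `K` is invariant under `a`, where `Δ(a) = a ⊗ A + B ⊗ a`, and under the group-like elements
`A` and `B`. -/
structure PolInvariant {q : Par} {Y₁ Y₂ : QSpace} (u : UGen) (K : Pol₂ q Y₁ Y₂) : Prop where
  act : act₂ q Y₁ Y₂ u K = 0
  actAA : actAA q Y₁ Y₂ u K = K
  actBB : actBB q Y₁ Y₂ u K = K

theorem PolInvariant.mul {q : Par} {Y₁ Y₂ : QSpace} {u : UGen} {K L : Pol₂ q Y₁ Y₂}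
    (hK : PolInvariant u K) (hL : PolInvariant u L) : PolInvariant u (K * L) where
  act := by
    have h := hL.act
    rw [act₂, LinearMap.add_apply] at h
    -- Invariance of `K` under `A ⊗ A` and `B ⊗ B` makes the last two terms recombine into `K` times
    -- the action on `L`.
    rw [act₂_mul, hK.act, hK.actAA, hK.actBB, zero_mul, zero_add, ← mul_add, h, mul_zero]
  actAA := by rw [actAA_mul, hK.actAA, hL.actAA]
  actBB := by rw [actBB_mul, hK.actBB, hL.actBB]

theorem polInvariant_one {q : Par} {Y₁ Y₂ : QSpace} (u : UGen) :
    PolInvariant u (1 : Pol₂ q Y₁ Y₂) := by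
  have e : (1 : Pol₂ q Y₁ Y₂) = MulOpposite.op 1 ⊗ₜ 1 := rfl
  have h0 (Y : QSpace) : QKernel.act q Y u 1 = 0 := by simpa using act_algebraMap q Y u 1
  have hA (Y : QSpace) : actA q Y u 1 = 1 := by simpa using actA_algebraMap q Y u 1
  have hB (Y : QSpace) : actB q Y u 1 = 1 := by simpa using actB_algebraMap q Y u 1
  constructor <;>
    simp only [e, act₂, actAA, actBB, LinearMap.add_apply, TensorProduct.map_tmul, opMap_op, h0, hA,
      hB, MulOpposite.op_zero, TensorProduct.zero_tmul, TensorProduct.tmul_zero, add_zero]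

theorem PolInvariant.pow {q : Par} {Y₁ Y₂ : QSpace} {u : UGen} {K : Pol₂ q Y₁ Y₂}
    (hK : PolInvariant u K) (l : ℕ) : PolInvariant u (K ^ l) := by
  induction l with
  | zero => rw [pow_zero]; exact polInvariant_one u
  | succ l ih => rw [pow_succ]; exact ih.mul hK

theorem act_H_t_zero (q : Par) (Y : QSpace) (i : Fin 2) : act q Y .H (t q Y i 0) = t q Y i 0 := by
  rw [act_t]; rfl

theorem act_H_t_one (q : Par) (Y : QSpace) (i : Fin 2) :
    act q Y .H (t q Y i 1) = (-1 : ℂ) • t q Y i 1 := by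
  exact (act_t q Y .H i 1).trans (neg_one_smul ℂ (t q Y i 1)).symm

theorem actA_H_t (q : Par) (Y : QSpace) (i j : Fin 2) : actA q Y .H (t q Y i j) = t q Y i j := by
  rw [actA_t]; fin_cases j <;> rfl

theorem actB_H_t (q : Par) (Y : QSpace) (i j : Fin 2) : actB q Y .H (t q Y i j) = t q Y i j := by
  rw [actB_t]; fin_cases j <;> rfl

theorem sub_smul_eq {M : Type*} [AddCommGroup M] [Module ℂ M] (c : ℂ) (x y : M) :
    x - c • y = x + (-c) • y := by module

theorem neg_smul_add_eq {M : Type*} [AddCommGroup M] [Module ℂ M] (c : ℂ) (x y : M) :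
    -(c • y) + x = x + (-c) • y := by module

theorem k11_eq (q : Par) (Y₁ Y₂ : QSpace) :
    k11 q Y₁ Y₂ = MulOpposite.op (t q Y₁ 0 0) ⊗ₜ t q Y₂ 1 1 +
      (-qc q) • (MulOpposite.op (t q Y₁ 0 1) ⊗ₜ t q Y₂ 1 0) := by
  simp only [k11, tl, tr, Algebra.TensorProduct.tmul_mul_tmul, mul_one, one_mul]
  exact sub_smul_eq (M := Pol₂ q Y₁ Y₂) _ _ _

theorem k22_eq (q : Par) (Y₁ Y₂ : QSpace) :
    k22 q Y₁ Y₂ = MulOpposite.op (t q Y₁ 1 1) ⊗ₜ t q Y₂ 0 0 +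
      (-(qc q)⁻¹) • (MulOpposite.op (t q Y₁ 1 0) ⊗ₜ t q Y₂ 0 1) := by
  simp only [k22, tl, tr, Algebra.TensorProduct.tmul_mul_tmul, mul_one, one_mul]
  exact neg_smul_add_eq (M := Pol₂ q Y₁ Y₂) _ _ _

/-- Each of `X^±` sends the two summands to multiples of one monomial, with coefficients `b` and `-q
b⁻¹` for `b = q^{1/2}`. -/
theorem polInvariant_k11 (q : Par) (Y₁ Y₂ : QSpace) (u : UGen) :
    PolInvariant u (k11 q Y₁ Y₂) := by
  have hb := qh_ne_zero q
  cases u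
  case H =>
    rw [k11_eq]
    constructor <;>
      simp only [act₂, actAA, actBB, LinearMap.add_apply, map_add, map_smul,
        TensorProduct.map_tmul, opMap_op, act_H_t_zero, act_H_t_one, actA_H_t, actB_H_t,
        MulOpposite.op_smul, ← TensorProduct.smul_tmul', TensorProduct.tmul_smul]
    module
  all_goals
    rw [k11_eq, ← qh_mul_self]
    constructor <;>
      simp only [act₂, actAA, actBB, LinearMap.add_apply, map_add, map_smul,
        TensorProduct.map_tmul, opMap_op, act_t, actA_t, actB_t] <;>
      simp [actMat, tri, TensorProduct.smul_tmul', TensorProduct.tmul_smul, smul_smul, hb]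
    rw [← TensorProduct.add_tmul, ← add_smul, add_neg_cancel, zero_smul, TensorProduct.zero_tmul]

theorem polInvariant_k22 (q : Par) (Y₁ Y₂ : QSpace) (u : UGen) :
    PolInvariant u (k22 q Y₁ Y₂) := by
  have hb := qh_ne_zero q
  cases u
  case H =>
    rw [k22_eq]
    constructor <;>
      simp only [act₂, actAA, actBB, LinearMap.add_apply, map_add, map_smul,
        TensorProduct.map_tmul, opMap_op, act_H_t_zero, act_H_t_one, actA_H_t, actB_H_t,
        MulOpposite.op_smul, ← TensorProduct.smul_tmul', TensorProduct.tmul_smul]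
    module
  all_goals
    rw [k22_eq, ← qh_mul_self]
    constructor <;>
      simp only [act₂, actAA, actBB, LinearMap.add_apply, map_add, map_smul,
        TensorProduct.map_tmul, opMap_op, act_t, actA_t, actB_t] <;>
      simp [actMat, tri, TensorProduct.smul_tmul', TensorProduct.tmul_smul, smul_smul, hb]
    rw [← TensorProduct.add_tmul, ← add_smul, add_neg_cancel, zero_smul, TensorProduct.zero_tmul]

/-! ### Powers of two-term shift operators -/

/-- The operator `g(z) ↦ w(z) g(z + d) + v(z) g(z + e)`. -/
def twoTerm {Z : Type*} [AddCommGroup Z] (d e : Z) (w v : Z → ℂ) (g : Z → ℂ) (z : Z) : ℂ :=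
  w z * g (z + d) + v z * g (z + e)

/-- The `Q`-binomial coefficient `[l, a]` as a polynomial in `x = Q^l`. -/
noncomputable def qbinom (Q : ℂ) (a : ℕ) (x : ℂ) : ℂ :=
  ∏ s ∈ Finset.range a, (1 - x * (Q ^ s)⁻¹) / (1 - Q ^ (s + 1))

theorem qbinom_zero (Q x : ℂ) : qbinom Q 0 x = 1 := rfl

/-- The `q`-Pascal rule, valid for arbitrary `x` and not only `x = Q^l`. After removal of the common
factor `qbinom Q a x` it reads `1 - Qx = (1 - xQ^{-a}) + xQ^{-a}(1 - Q^{a+1})`. -/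
theorem qbinom_succ {Q : ℂ} (hQ : Q ≠ 0) (hQ' : ∀ n : ℕ, Q ^ (n + 1) ≠ 1) (a : ℕ) (x : ℂ) :
    qbinom Q (a + 1) (Q * x) = qbinom Q (a + 1) x + x * (Q ^ a)⁻¹ * qbinom Q a x := by
  have h1 : qbinom Q (a + 1) (Q * x) = qbinom Q a x * ((1 - Q * x) / (1 - Q ^ (a + 1))) := by
    simp only [qbinom, Finset.prod_div_distrib]
    rw [Finset.prod_range_succ', Finset.prod_range_succ (fun s => 1 - Q ^ (s + 1)),
      Finset.prod_congr rfl fun s _ => (show 1 - Q * x * (Q ^ (s + 1))⁻¹ = 1 - x * (Q ^ s)⁻¹ by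
        rw [pow_succ]; field_simp)]
    simp only [pow_zero, inv_one, mul_one]
    rw [mul_div_mul_comm]
  have h2 : 1 - Q ^ (a + 1) ≠ 0 := sub_ne_zero.2 (hQ' a).symm
  rw [h1, show qbinom Q (a + 1) x = qbinom Q a x * ((1 - x * (Q ^ a)⁻¹) / (1 - Q ^ (a + 1))) from
    Finset.prod_range_succ _ _]
  field_simp
  ring

theorem qbinom_eq_zero {Q : ℂ} (hQ : Q ≠ 0) {a l : ℕ} (h : l < a) : qbinom Q a (Q ^ l) = 0 := by
  refine Finset.prod_eq_zero (Finset.mem_range.2 h) ?_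
  rw [mul_inv_cancel₀ (pow_ne_zero _ hQ), sub_self, zero_div]

/-- The `q`-binomial theorem: the hypotheses say that `S = w·(shift by d)` and `R = v·(shift by e)`
satisfy `SR = Q RS`, whence `(S + R)^l = ∑ [l, a] R^{l-a} S^a`. The bound `N` is free because the
binomials vanish for `a > l`; the negative powers of `v` occurring there are harmless. -/
theorem twoTerm_iterate {Z : Type*} [AddCommGroup Z] {d e : Z} {w v : Z → ℂ} {Q : ℂ} (hQ : Q ≠ 0)
    (hQ' : ∀ n : ℕ, Q ^ (n + 1) ≠ 1) (hw : ∀ z, w (z + e) = w z) (hve : ∀ z, v (z + e) = v z)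
    (hvd : ∀ z, v (z + d) = Q * v z) (hv : ∀ z, v z ≠ 0) (g : Z → ℂ) (l N : ℕ) (hN : l < N)
    (z : Z) :
    (twoTerm d e w v)^[l] g z = ∑ a ∈ Finset.range N,
      (∏ s ∈ Finset.range a, w (z + (s : ℤ) • d)) * v z ^ ((l : ℤ) - a) * qbinom Q a (Q ^ l) *
        g (z + (a : ℤ) • d + ((l : ℤ) - a) • e) := by
  induction l generalizing N z with
  | zero =>
    obtain ⟨M, rfl⟩ := Nat.exists_eq_succ_of_ne_zero hN.ne'
    rw [Finset.sum_range_succ', Finset.sum_eq_zero fun a _ => by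
      rw [qbinom_eq_zero hQ (Nat.succ_pos a)]; ring]
    simp [qbinom_zero]
  | succ l ih =>
    obtain ⟨M, rfl⟩ := Nat.exists_eq_succ_of_ne_zero (Nat.ne_zero_of_lt hN)
    -- The shift by `d` raises `a` by one, so its sum is taken up to `M` and the other up to `M +
    -- 1`. The terms then pair off by the Pascal rule, leaving `a = 0`.
    rw [Function.iterate_succ_apply', twoTerm, ih M (by omega), ih (M + 1) (by omega),
      Finset.sum_range_succ', Finset.sum_range_succ', mul_add, ← add_assoc]
    congr 1
    · rw [Finset.mul_sum, Finset.mul_sum, ← Finset.sum_add_distrib]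
      refine Finset.sum_congr rfl fun a _ => ?_
      have e1 : z + d + (a : ℤ) • d + ((l : ℤ) - a) • e =
          z + ((a + 1 : ℕ) : ℤ) • d + (((l + 1 : ℕ) : ℤ) - (a + 1 : ℕ)) • e := by
        push_cast; module
      have e2 : z + e + ((a + 1 : ℕ) : ℤ) • d + ((l : ℤ) - (a + 1 : ℕ)) • e =
          z + ((a + 1 : ℕ) : ℤ) • d + (((l + 1 : ℕ) : ℤ) - (a + 1 : ℕ)) • e := by
        push_cast; module
      have e3 : ∏ s ∈ Finset.range (a + 1), w (z + (s : ℤ) • d) =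
          w z * ∏ s ∈ Finset.range a, w (z + d + (s : ℤ) • d) := by
        rw [Finset.prod_range_succ', mul_comm]
        congr 1
        · simp
        · refine Finset.prod_congr rfl fun s _ => ?_
          congr 1; push_cast; module
      have e4 : ∏ s ∈ Finset.range (a + 1), w (z + e + (s : ℤ) • d) =
          ∏ s ∈ Finset.range (a + 1), w (z + (s : ℤ) • d) :=
        Finset.prod_congr rfl fun s _ => by rw [← hw (z + (s : ℤ) • d)]; congr 1; module
      have e5 : v z * v z ^ ((l : ℤ) - (a + 1 : ℕ)) = v z ^ ((l : ℤ) - a) := by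
        rw [← zpow_one_add₀ (hv z)]; congr 1; push_cast; ring
      have e6 : (((l + 1 : ℕ) : ℤ) - (a + 1 : ℕ)) = (l : ℤ) - a := by push_cast; ring
      have e7 : Q ^ ((l : ℤ) - a) = Q ^ l * (Q ^ a)⁻¹ := by
        rw [zpow_sub₀ hQ, zpow_natCast, zpow_natCast, div_eq_mul_inv]
      rw [e1, e2, e4, e3, hve, hvd, e6, pow_succ' Q l, qbinom_succ hQ hQ', ← e5, mul_zpow, e7, ← e5]
      ring
    · have e1 : z + e + ((0 : ℕ) : ℤ) • d + ((l : ℤ) - (0 : ℕ)) • e =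
          z + ((0 : ℕ) : ℤ) • d + (((l + 1 : ℕ) : ℤ) - (0 : ℕ)) • e := by
        push_cast; module
      have e5 : v z ^ (((l + 1 : ℕ) : ℤ) - (0 : ℕ)) = v z * v z ^ ((l : ℤ) - (0 : ℕ)) := by
        rw [← zpow_one_add₀ (hv z)]; congr 1; push_cast; ring
      rw [e1, e5, hve]
      simp only [Finset.range_zero, Finset.prod_empty, qbinom_zero]
      ring

/-! ### Matrix elements of the kernels -/

theorem rho_t00 (q : Par) (Y : QSpace) :
    rho q Y (t q Y 0 0) = wshift (1, 0) (fun _ => 1) := rho_t q Y 0 0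

theorem rho_t01 (q : Par) (Y : QSpace) :
    rho q Y (t q Y 0 1) = wshift (0, 1) (fun m => qc q ^ (-m)) := rho_t q Y 0 1

theorem rho_t10 (q : Par) (Y : QSpace) :
    rho q Y (t q Y 1 0) = wshift (0, -1) (fun m => -((qc q)⁻¹ * qc q ^ (-m))) := rho_t q Y 1 0

theorem rho_t11 (q : Par) (Y : QSpace) :
    rho q Y (t q Y 1 1) = wshift (-1, 0) (fun m => -(qc q ^ (-2 * m) - Y.c)) := rho_t q Y 1 1

/-- Pairs of basis vectors of the two realizations. -/
abbrev Z₂ := (ℤ × ℤ) × (ℤ × ℤ)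

/-- Matrix elements on `Pol(Y₁ × Y₂)_q`: for the pairs `o = (p₁, p₂')` and `z = (p₁', p₂)`, the value
on `f₁ ⊗ f₂` is `⟨p₁'| f₁ |p₁⟩ ⟨p₂'| f₂ |p₂⟩`. -/
noncomputable def matEl₂ (q : Par) (Y₁ Y₂ : QSpace) (o z : Z₂) : Pol₂ q Y₁ Y₂ →ₗ[ℂ] ℂ :=
  LinearMap.mul' ℂ ℂ ∘ₗ TensorProduct.map
    (matEl q Y₁ o.1 z.1 ∘ₗ (MulOpposite.opLinearEquiv ℂ).symm.toLinearMap) (matEl q Y₂ z.2 o.2)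

theorem matEl₂_tmul (q : Par) (Y₁ Y₂ : QSpace) (o z : Z₂) (a : Pol q Y₁) (b : Pol q Y₂) :
    matEl₂ q Y₁ Y₂ o z (MulOpposite.op a ⊗ₜ b) = matEl q Y₁ o.1 z.1 a * matEl q Y₂ z.2 o.2 b := by
  simp [matEl₂]

theorem matEl₂_one (q : Par) (Y₁ Y₂ : QSpace) (o z : Z₂) :
    matEl₂ q Y₁ Y₂ o z 1 = if o = z then 1 else 0 := by
  rw [show (1 : Pol₂ q Y₁ Y₂) = MulOpposite.op 1 ⊗ₜ 1 from rfl, matEl₂_tmul, matEl_one, matEl_one,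
    ite_zero_mul_ite_zero, one_mul]
  simp only [Prod.ext_iff (x := o), eq_comm (a := z.2)]

/-- The coefficients of right multiplication by `k₁₁`. -/
noncomputable def w11 (q : Par) (Y₂ : QSpace) (z : Z₂) : ℂ := -(qc q ^ (-2 * z.2.1) - Y₂.c)

/-- The coefficients of right multiplication by `k₁₁`. -/
noncomputable def v11 (q : Par) (z : Z₂) : ℂ := qc q ^ (-(z.1.1 + z.2.1))

/-- The coefficients of right multiplication by `k₂₂`. -/
noncomputable def w22 (q : Par) (Y₁ : QSpace) (z : Z₂) : ℂ := -(qc q ^ (-2 * (z.1.1 + 1)) - Y₁.c)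

/-- The coefficients of right multiplication by `k₂₂`. -/
noncomputable def v22 (q : Par) (z : Z₂) : ℂ := qc q ^ (-2 - (z.1.1 + z.2.1))

theorem matEl₂_mul_k11 (q : Par) (Y₁ Y₂ : QSpace) (o : Z₂) (K : Pol₂ q Y₁ Y₂) :
    (fun z => matEl₂ q Y₁ Y₂ o z (K * k11 q Y₁ Y₂)) =
      twoTerm ((-1, 0), (-1, 0)) ((0, -1), (0, -1)) (w11 q Y₂) (v11 q)
        (fun z => matEl₂ q Y₁ Y₂ o z K) := by
  have hq := qc_ne_zero q
  funext z
  induction K using Pol₂.induction with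
  | zero => simp [twoTerm]
  | add K L hK hL =>
    simp only [twoTerm, add_mul, map_add] at hK hL ⊢
    rw [hK, hL]
    ring
  | tmul a b =>
    simp only [k11_eq, mul_add, mul_smul_comm, Algebra.TensorProduct.tmul_mul_tmul,
      ← MulOpposite.op_mul, map_add, map_smul, matEl₂_tmul, twoTerm]
    rw [matEl_shift_mul q Y₁ _ _ _ _ _ _ (rho_t00 q Y₁),
      matEl_shift_mul q Y₁ _ _ _ _ _ _ (rho_t01 q Y₁),
      matEl_mul_shift q Y₂ _ _ _ _ _ _ (rho_t10 q Y₂),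
      matEl_mul_shift q Y₂ _ _ _ _ _ _ (rho_t11 q Y₂)]
    simp only [sub_eq_add_neg z.1, w11, v11, Prod.neg_mk, Prod.fst_add, Prod.snd_add, neg_zero,
      add_zero, neg_add, zpow_add₀ hq, smul_eq_mul]
    field_simp

theorem matEl₂_mul_k22 (q : Par) (Y₁ Y₂ : QSpace) (o : Z₂) (K : Pol₂ q Y₁ Y₂) :
    (fun z => matEl₂ q Y₁ Y₂ o z (K * k22 q Y₁ Y₂)) =
      twoTerm ((1, 0), (1, 0)) ((0, 1), (0, 1)) (w22 q Y₁) (v22 q)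
        (fun z => matEl₂ q Y₁ Y₂ o z K) := by
  have hq := qc_ne_zero q
  funext z
  induction K using Pol₂.induction with
  | zero => simp [twoTerm]
  | add K L hK hL =>
    simp only [twoTerm, add_mul, map_add] at hK hL ⊢
    rw [hK, hL]
    ring
  | tmul a b =>
    simp only [k22_eq, mul_add, mul_smul_comm, Algebra.TensorProduct.tmul_mul_tmul,
      ← MulOpposite.op_mul, map_add, map_smul, matEl₂_tmul, twoTerm]
    rw [matEl_shift_mul q Y₁ _ _ _ _ _ _ (rho_t11 q Y₁),
      matEl_shift_mul q Y₁ _ _ _ _ _ _ (rho_t10 q Y₁),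
      matEl_mul_shift q Y₂ _ _ _ _ _ _ (rho_t01 q Y₂),
      matEl_mul_shift q Y₂ _ _ _ _ _ _ (rho_t00 q Y₂)]
    have e2 : qc q ^ (-2 : ℤ) = (qc q)⁻¹ * (qc q)⁻¹ := by
      rw [zpow_neg]; norm_cast; rw [sq, mul_inv]
    simp only [sub_eq_add_neg z.1, sub_eq_add_neg (-2 : ℤ), w22, v22, Prod.neg_mk, Prod.fst_add,
      Prod.snd_add, neg_zero, neg_neg, add_zero, neg_add (_ : ℤ), zpow_add₀ hq, smul_eq_mul, e2]
    ring

theorem matEl₂_mul_pow {q : Par} {Y₁ Y₂ : QSpace} {k : Pol₂ q Y₁ Y₂} {o : Z₂}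
    {T : (Z₂ → ℂ) → Z₂ → ℂ}
    (h : ∀ K, (fun z => matEl₂ q Y₁ Y₂ o z (K * k)) = T (fun z => matEl₂ q Y₁ Y₂ o z K))
    (K : Pol₂ q Y₁ Y₂) (l : ℕ) :
    (fun z => matEl₂ q Y₁ Y₂ o z (K * k ^ l)) = T^[l] (fun z => matEl₂ q Y₁ Y₂ o z K) := by
  induction l with
  | zero => simp
  | succ l ih => rw [Function.iterate_succ_apply', ← ih, ← h, pow_succ, mul_assoc]

/-! ### Laurent polynomial functions -/

/-- A function of a nonzero complex variable given by a Laurent polynomial. -/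
def IsLaurent (F : ℂˣ → ℂ) : Prop :=
  ∃ P : LaurentPolynomial ℂ, ∀ z : ℂˣ, F z = LaurentPolynomial.eval₂ (RingHom.id ℂ) z P

theorem isLaurent_const (c : ℂ) : IsLaurent fun _ => c :=
  ⟨LaurentPolynomial.C c, fun z => by simp⟩

theorem isLaurent_zpow (n : ℤ) : IsLaurent fun z => ((z ^ n : ℂˣ) : ℂ) :=
  ⟨LaurentPolynomial.T n, fun z => by simp⟩

theorem IsLaurent.mul {F G : ℂˣ → ℂ} (hF : IsLaurent F) (hG : IsLaurent G) :
    IsLaurent fun z => F z * G z := by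
  obtain ⟨P, hP⟩ := hF
  obtain ⟨R, hR⟩ := hG
  exact ⟨P * R, fun z => by rw [map_mul, ← hP, ← hR]⟩

theorem IsLaurent.sub {F G : ℂˣ → ℂ} (hF : IsLaurent F) (hG : IsLaurent G) :
    IsLaurent fun z => F z - G z := by
  obtain ⟨P, hP⟩ := hF
  obtain ⟨R, hR⟩ := hG
  exact ⟨P - R, fun z => by rw [map_sub, ← hP, ← hR]⟩

theorem IsLaurent.sum {ι : Type*} {s : Finset ι} {F : ι → ℂˣ → ℂ}
    (hF : ∀ i ∈ s, IsLaurent (F i)) : IsLaurent fun z => ∑ i ∈ s, F i z := by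
  choose! P hP using hF
  exact ⟨∑ i ∈ s, P i, fun z => by
    rw [map_sum]; exact Finset.sum_congr rfl fun i hi => hP i hi z⟩

theorem IsLaurent.prod {ι : Type*} {s : Finset ι} {F : ι → ℂˣ → ℂ}
    (hF : ∀ i ∈ s, IsLaurent (F i)) : IsLaurent fun z => ∏ i ∈ s, F i z := by
  choose! P hP using hF
  exact ⟨∏ i ∈ s, P i, fun z => by
    rw [map_prod]; exact Finset.prod_congr rfl fun i hi => hP i hi z⟩

/-- A Laurent polynomial vanishing at infinitely many points is zero. -/
theorem IsLaurent.eq_zero {F : ℂˣ → ℂ} (hF : IsLaurent F) {u : ℕ → ℂˣ} (hu : Function.Injective u)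
    (h : ∀ l, F (u l) = 0) (z : ℂˣ) : F z = 0 := by
  obtain ⟨P, hP⟩ := hF
  obtain ⟨n, R, hR⟩ := P.exists_T_pow
  -- Multiplying by a power of the variable clears the negative exponents.
  have e (z : ℂˣ) : R.eval (z : ℂ) = F z * ((z ^ (n : ℤ) : ℂˣ) : ℂ) := by
    have h := congrArg (LaurentPolynomial.eval₂ (RingHom.id ℂ) z) hR
    rw [LaurentPolynomial.eval₂_toLaurent, map_mul, LaurentPolynomial.eval₂_T, ← hP] at h
    exact h
  have hR0 : R = 0 := by
    refine Polynomial.eq_zero_of_infinite_isRoot R ?_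
    refine (Set.infinite_range_of_injective
      (Units.val_injective.comp hu : Function.Injective fun l => (u l : ℂ))).mono ?_
    rintro _ ⟨l, rfl⟩
    exact (e (u l)).trans (by rw [h, zero_mul])
  have := e z
  rw [hR0, Polynomial.eval_zero] at this
  exact (mul_eq_zero.1 this.symm).resolve_right (Units.ne_zero _)

theorem qUnit_pow_injective (q : Par) : Function.Injective fun l : ℕ => qUnit q ^ (2 * l) := by
  intro a b h
  have h' : (q : ℝ) ^ (2 * a) = (q : ℝ) ^ (2 * b) := by
    have := congrArg Units.val h
    simp only [qUnit, qc, Units.val_pow_eq_pow_val, Units.val_mk0] at this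
    exact_mod_cast this
  have := pow_right_injective₀ q.2.1 q.2.2.ne h'
  omega

/-! ### Interpolation of the matrix elements of `k₂₂^l k₁₁^l` -/

/-- A summand of the expansion of a matrix element of `k₂₂^l k₁₁^l` as a function of `x = q^{2l}`. -/
noncomputable def kernelTerm (q : Par) (Y₁ Y₂ : QSpace) (o z : Z₂) (a b : ℕ) (x : ℂˣ) : ℂ :=
  (∏ s ∈ Finset.range a, (Y₂.c - qc q ^ (-2 * (z.2.1 - s)))) *
    (∏ s ∈ Finset.range b, (Y₁.c - qc q ^ (-2 * (z.1.1 - a + s + 1)))) *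
    qc q ^ ((z.1.1 + z.2.1) * a + (2 + (z.1.1 + z.2.1) - 2 * a) * b) *
    (if o = z + ((a : ℤ) - b) • (((-1, 1), (-1, 1)) : Z₂) then 1 else 0) *
    (qbinom (qc q ^ 2) a x * qbinom ((qc q)⁻¹ ^ 2) b (x⁻¹ : ℂˣ) *
      ((x ^ ((a : ℤ) - 1 - (z.1.1 + z.2.1)) : ℂˣ) : ℂ))

theorem qc_sq_pow_ne_one (q : Par) (n : ℕ) : (qc q ^ 2) ^ (n + 1) ≠ 1 := by
  rw [← pow_mul, qc]
  have : (q : ℝ) ^ (2 * (n + 1)) < 1 := pow_lt_one₀ q.2.1.le q.2.2 (by omega)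
  exact_mod_cast this.ne

theorem v11_ne_zero (q : Par) (z : Z₂) : v11 q z ≠ 0 := zpow_ne_zero _ (qc_ne_zero q)

theorem v22_ne_zero (q : Par) (z : Z₂) : v22 q z ≠ 0 := zpow_ne_zero _ (qc_ne_zero q)

theorem v11_add (q : Par) (z : Z₂) : v11 q (z + ((-1, 0), (-1, 0))) = qc q ^ 2 * v11 q z := by
  have hq := qc_ne_zero q
  rw [← zpow_natCast, v11, v11, ← zpow_add₀ hq]
  congr 1
  simp only [Prod.fst_add, Prod.snd_add]
  push_cast
  ring

theorem v22_add (q : Par) (z : Z₂) : v22 q (z + ((1, 0), (1, 0))) = (qc q)⁻¹ ^ 2 * v22 q z := by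
  have hq := qc_ne_zero q
  rw [← zpow_natCast, v22, v22, inv_zpow', ← zpow_add₀ hq]
  congr 1
  simp only [Prod.fst_add, Prod.snd_add]
  push_cast
  ring

/-- The `q`-binomial theorem is used with `Q = q²` for `k₁₁` and `Q = q⁻²` for `k₂₂`, which is why
the second binomial is evaluated at `x⁻¹`. -/
theorem matEl₂_kernel (q : Par) (Y₁ Y₂ : QSpace) (o z : Z₂) (l N : ℕ) (hN : l < N) :
    matEl₂ q Y₁ Y₂ o z (k22 q Y₁ Y₂ ^ l * k11 q Y₁ Y₂ ^ l) =
      ∑ a ∈ Finset.range N, ∑ b ∈ Finset.range N,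
        kernelTerm q Y₁ Y₂ o z a b (qUnit q ^ (2 * l)) := by
  have hq := qc_ne_zero q
  have h1 := congrFun (matEl₂_mul_pow (matEl₂_mul_k11 q Y₁ Y₂ o) (k22 q Y₁ Y₂ ^ l) l) z
  have h2 := matEl₂_mul_pow (matEl₂_mul_k22 q Y₁ Y₂ o) 1 l
  rw [one_mul] at h2
  rw [h1, h2, twoTerm_iterate (pow_ne_zero 2 hq) (qc_sq_pow_ne_one q)
    (fun z => by simp [w11]) (fun z => by simp [v11]) (v11_add q) (v11_ne_zero q) _ l N hN]
  refine Finset.sum_congr rfl fun a _ => ?_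
  rw [twoTerm_iterate (pow_ne_zero 2 (inv_ne_zero hq))
    (fun n => by rw [inv_pow, inv_pow, Ne, inv_eq_one]; exact qc_sq_pow_ne_one q n)
    (fun z => by simp [w22]) (fun z => by simp [v22]) (v22_add q) (v22_ne_zero q) _ l N hN,
    Finset.mul_sum]
  refine Finset.sum_congr rfl fun b _ => ?_
  have hx : ((qUnit q ^ (2 * l) : ℂˣ) : ℂ) = (qc q ^ 2) ^ l := by
    simp [qUnit, pow_mul]
  have hx' : (((qUnit q ^ (2 * l))⁻¹ : ℂˣ) : ℂ) = ((qc q)⁻¹ ^ 2) ^ l := by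
    simp [qUnit, pow_mul]
  have hP1 : ∏ s ∈ Finset.range a, w11 q Y₂ (z + (s : ℤ) • ((-1, 0), (-1, 0))) =
      ∏ s ∈ Finset.range a, (Y₂.c - qc q ^ (-2 * (z.2.1 - s))) :=
    Finset.prod_congr rfl fun s _ => by simp [w11, sub_eq_add_neg]
  have hP2 : ∏ s ∈ Finset.range b, w22 q Y₁ (z + (a : ℤ) • ((-1, 0), (-1, 0)) +
      ((l : ℤ) - a) • ((0, -1), (0, -1)) + (s : ℤ) • ((1, 0), (1, 0))) =
      ∏ s ∈ Finset.range b, (Y₁.c - qc q ^ (-2 * (z.1.1 - a + s + 1))) :=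
    Finset.prod_congr rfl fun s _ => by simp [w22, sub_eq_add_neg]
  -- The coefficient of `l` in the total exponent of `q` is even, so the dependence on `l` is an
  -- integral power of `x = q^{2l}`.
  have hE : v11 q z ^ ((l : ℤ) - a) * v22 q (z + (a : ℤ) • ((-1, 0), (-1, 0)) +
      ((l : ℤ) - a) • ((0, -1), (0, -1))) ^ ((l : ℤ) - b) =
      qc q ^ ((z.1.1 + z.2.1) * a + (2 + (z.1.1 + z.2.1) - 2 * a) * b) *
        (((qUnit q ^ (2 * l)) ^ ((a : ℤ) - 1 - (z.1.1 + z.2.1)) : ℂˣ) : ℂ) := by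
    rw [Units.val_zpow_eq_zpow_val, hx, ← pow_mul, ← zpow_natCast (qc q), ← zpow_mul, v11, v22,
      ← zpow_mul, ← zpow_mul, ← zpow_add₀ hq, ← zpow_add₀ hq]
    congr 1
    simp
    ring
  -- The shifts without `w` are opposite for the two kernels, so `l` drops out of the final
  -- position.
  have hz : z + (a : ℤ) • ((-1, 0), (-1, 0)) + ((l : ℤ) - a) • ((0, -1), (0, -1)) +
      (b : ℤ) • ((1, 0), (1, 0)) + ((l : ℤ) - b) • ((0, 1), (0, 1)) =
      z + ((a : ℤ) - b) • (((-1, 1), (-1, 1)) : Z₂) := by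
    ext <;> simp <;> ring
  rw [matEl₂_one, kernelTerm, hx, hx', hP1, hP2, hz]
  linear_combination (∏ s ∈ Finset.range a, (Y₂.c - qc q ^ (-2 * (z.2.1 - s)))) *
    (∏ s ∈ Finset.range b, (Y₁.c - qc q ^ (-2 * (z.1.1 - a + s + 1)))) *
    (if o = z + ((a : ℤ) - b) • (((-1, 1), (-1, 1)) : Z₂) then 1 else 0) *
    qbinom (qc q ^ 2) a ((qc q ^ 2) ^ l) * qbinom ((qc q)⁻¹ ^ 2) b (((qc q)⁻¹ ^ 2) ^ l) * hE

theorem isLaurent_qbinom (Q : ℂ) (a : ℕ) : IsLaurent fun x => qbinom Q a x := by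
  refine IsLaurent.prod fun s _ => ?_
  simp only [div_eq_mul_inv]
  refine ((isLaurent_const 1).sub (IsLaurent.mul ?_ (isLaurent_const _))).mul (isLaurent_const _)
  simpa using isLaurent_zpow 1

theorem isLaurent_qbinom_inv (Q : ℂ) (a : ℕ) :
    IsLaurent fun x => qbinom Q a ((x⁻¹ : ℂˣ) : ℂ) := by
  refine IsLaurent.prod fun s _ => ?_
  simp only [div_eq_mul_inv]
  refine ((isLaurent_const 1).sub (IsLaurent.mul ?_ (isLaurent_const _))).mul (isLaurent_const _)
  simpa using isLaurent_zpow (-1)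

theorem isLaurent_kernelTerm (q : Par) (Y₁ Y₂ : QSpace) (o z : Z₂) (a b : ℕ) :
    IsLaurent (kernelTerm q Y₁ Y₂ o z a b) :=
  (isLaurent_const _).mul
    (((isLaurent_qbinom _ _).mul (isLaurent_qbinom_inv _ _)).mul (isLaurent_zpow _))

theorem kernelTerm_eq_zero_of_ne (q : Par) (Y₁ Y₂ : QSpace) (o z : Z₂) (a b : ℕ) (x : ℂˣ)
    (h : o.1.1 ≠ z.1.1 - a + b) : kernelTerm q Y₁ Y₂ o z a b x = 0 := by
  rw [kernelTerm, if_neg, mul_zero, zero_mul]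
  rintro rfl
  apply h
  simp
  ring

theorem kernelTerm_eq_zero (q : Par) (Y₁ Y₂ : QSpace) (hY : Y₁ = .X ∨ Y₂ = .X) (o z : Z₂)
    (ho : Y₁ = .X → 0 ≤ o.1.1) (hz : Y₂ = .X → 0 ≤ z.2.1) (a b : ℕ) (x : ℂˣ)
    (h₁ : z.1.1 < a) (h₂ : z.2.1 < a) : kernelTerm q Y₁ Y₂ o z a b x = 0 := by
  by_cases h : o.1.1 = z.1.1 - a + b
  · rw [kernelTerm]
    rcases hY with rfl | rfl
    · have h0 := ho rfl
      -- This factor is `1 - q^0`. Its index is less than `b` because `b - a + z.1.1 = o.1.1 ≥ 0`.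
      rw [Finset.prod_eq_zero (s := Finset.range b) (i := (a - 1 - z.1.1).toNat)
        (Finset.mem_range.2 (by omega))]
      · simp
      · rw [show -2 * (z.1.1 - a + ((a - 1 - z.1.1).toNat : ℤ) + 1) = 0 by omega, zpow_zero]
        exact sub_self _
    -- For `Y₂ = X̃` the vanishing factor lies in the first product, at `s = z.2.1 < a`.
    · have h0 := hz rfl
      rw [Finset.prod_eq_zero (s := Finset.range a) (i := z.2.1.toNat)
        (Finset.mem_range.2 (by omega))]
      · simp
      · rw [show -2 * (z.2.1 - (z.2.1.toNat : ℤ)) = 0 by omega, zpow_zero]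
        exact sub_self _
  · exact kernelTerm_eq_zero_of_ne q Y₁ Y₂ o z a b x h

/-- The Laurent polynomial in `x` interpolating the matrix elements of `k₂₂^l k₁₁^l`, `x = q^{2l}`. -/
noncomputable def kernelEl (q : Par) (Y₁ Y₂ : QSpace) (o z : Z₂) (x : ℂˣ) : ℂ :=
  ∑ a ∈ Finset.range (z.1.1.toNat + z.2.1.toNat + 1),
    ∑ b ∈ Finset.range ((o.1.1 - z.1.1).toNat + (z.1.1.toNat + z.2.1.toNat + 1)),
      kernelTerm q Y₁ Y₂ o z a b x

theorem isLaurent_kernelEl (q : Par) (Y₁ Y₂ : QSpace) (o z : Z₂) :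
    IsLaurent (kernelEl q Y₁ Y₂ o z) :=
  IsLaurent.sum fun _ _ => IsLaurent.sum fun _ _ => isLaurent_kernelTerm q Y₁ Y₂ o z _ _

/-- The ranges in `kernelEl` do not involve `l`. Beyond them either both levels of `z` are below
`a`, or the constraint `o.1.1 = z.1.1 - a + b` fails. -/
theorem kernelEl_pow (q : Par) (Y₁ Y₂ : QSpace) (hY : Y₁ = .X ∨ Y₂ = .X) (o z : Z₂)
    (ho : Y₁ = .X → 0 ≤ o.1.1) (hz : Y₂ = .X → 0 ≤ z.2.1) (l : ℕ) :
    kernelEl q Y₁ Y₂ o z (qUnit q ^ (2 * l)) =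
      matEl₂ q Y₁ Y₂ o z (k22 q Y₁ Y₂ ^ l * k11 q Y₁ Y₂ ^ l) := by
  set A := z.1.1.toNat + z.2.1.toNat + 1 with hA
  set B := (o.1.1 - z.1.1).toNat + A with hB
  rw [matEl₂_kernel q Y₁ Y₂ o z l (l + 1 + B) (by omega), kernelEl]
  rw [← Finset.sum_subset (Finset.range_mono (show A ≤ l + 1 + B by omega))]
  · refine Finset.sum_congr rfl fun a ha => ?_
    refine Finset.sum_subset (Finset.range_mono (by omega)) fun b _ hb => ?_
    rw [Finset.mem_range] at ha hb
    exact kernelTerm_eq_zero_of_ne q Y₁ Y₂ o z a b _ (by omega)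
  · intro a _ ha
    rw [Finset.mem_range] at ha
    exact Finset.sum_eq_zero fun b _ =>
      kernelTerm_eq_zero q Y₁ Y₂ hY o z ho hz a b _ (by omega) (by omega)

/-! ### The interpolating kernel -/

/-- The pair `(p₁, p₂')` of the matrix element defining a coefficient of a distribution. -/
def outIdx {Y₁ Y₂ : QSpace} (p : Idx Y₁ × Idx Y₂) : Z₂ :=
  ((p.1.m + p.1.j₁, 0), (p.2.m + p.2.i₁, (p.2.i₂ : ℤ) - p.2.j₂))

/-- The pair `(p₁', p₂)` of the matrix element defining a coefficient of a distribution. -/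
def inIdx {Y₁ Y₂ : QSpace} (p : Idx Y₁ × Idx Y₂) : Z₂ :=
  ((p.1.m + p.1.i₁, (p.1.i₂ : ℤ) - p.1.j₂), (p.2.m + p.2.j₁, 0))

theorem toDist_eq (q : Par) (Y₁ Y₂ : QSpace) (K : Pol₂ q Y₁ Y₂) (p : Idx Y₁ × Idx Y₂) :
    toDist q Y₁ Y₂ K p = (entry p.1 (finOp q p.1))⁻¹ * (entry p.2 (finOp q p.2))⁻¹ *
      matEl₂ q Y₁ Y₂ (outIdx p) (inIdx p) K := by
  induction K using Pol₂.induction with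
  | zero => simp
  | add K L hK hL => rw [map_add, map_add, Pi.add_apply, hK, hL, mul_add]
  | tmul a b =>
    rw [toDist_tmul, matEl₂_tmul, polCoeff_eq, polCoeff_eq, LinearMap.smul_apply,
      LinearMap.smul_apply, smul_eq_mul, smul_eq_mul, outIdx, inIdx]
    ring

/-- The kernel interpolating `k₂₂^l k₁₁^l`. -/
noncomputable def kernel (q : Par) (Y₁ Y₂ : QSpace) (x : ℂˣ) : Dist₂ Y₁ Y₂ := fun p =>
  (entry p.1 (finOp q p.1))⁻¹ * (entry p.2 (finOp q p.2))⁻¹ *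
    kernelEl q Y₁ Y₂ (outIdx p) (inIdx p) x

theorem interpolates_kernel (q : Par) (Y₁ Y₂ : QSpace) (hY : Y₁ = .X ∨ Y₂ = .X) :
    Interpolates q (kernel q Y₁ Y₂) := fun l => by
  funext p
  rw [toDist_eq, kernel, kernelEl_pow q Y₁ Y₂ hY]
  · intro h
    have := p.1.hm h
    simp only [outIdx]
    positivity
  · intro h
    have := p.2.hm h
    simp only [inIdx]
    positivity

theorem isLaurent_kernel (q : Par) (Y₁ Y₂ : QSpace) (p : Idx Y₁ × Idx Y₂) :
    IsLaurent fun x => kernel q Y₁ Y₂ x p :=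
  (isLaurent_const _).mul (isLaurent_kernelEl _ _ _ _ _)

/-! ### Polynomial functions with values in distributions -/

theorem pair_eq_sum (q : Par) {Y₁ Y₂ : QSpace} (K : Dist₂ Y₁ Y₂) (φ : Fin₂ Y₁ Y₂) :
    pair q K φ = ∑ p ∈ (form_finite q φ).toFinset, K p * form q (Finsupp.single p 1) φ := by
  rw [pair]
  refine finsum_eq_sum_of_support_subset _ fun p hp => ?_
  simpa using right_ne_zero_of_mul hp

theorem isPolynomial_of_isLaurent (q : Par) {Y₁ Y₂ : QSpace} {f : ℂˣ → Dist₂ Y₁ Y₂}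
    (hf : ∀ p, IsLaurent fun x => f x p) : IsPolynomial q f := fun φ => by
  simp only [pair_eq_sum]
  exact IsLaurent.sum fun p _ => (hf p).mul (isLaurent_const _)

/-- The index of the basis vector dual to `E_α`. -/
def Idx.partner {Y : QSpace} (α : Idx Y) : Idx Y :=
  ⟨α.j₁, α.j₂, α.i₁, α.i₂, α.m, by rw [mul_comm]; exact α.h₁, by rw [mul_comm]; exact α.h₂, α.hm⟩

/-- The product of `E_α` with its partner is diagonal and lives on the single level `m = α.m +
α.i₁`, so the integral has exactly one nonzero summand. -/
theorem nuMul_partner_ne_zero (q : Par) {Y : QSpace} (α : Idx Y) : nuMul q α α.partner ≠ 0 := by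
  have hq := qc_ne_zero q
  have hw (k : ℕ) : ∏ s ∈ Finset.range k, (qc q ^ (-2 * (α.m + k - s)) - Y.c) ≠ 0 :=
    Finset.prod_ne_zero_iff.2 fun s hs => weight_ne_zero q Y _ fun h => by
      have := α.hm h
      have := Finset.mem_range.1 hs
      omega
  have h1 : (1 : ℂ) - qc q ^ 2 ≠ 0 := sub_ne_zero.2 (by simpa using (qc_sq_pow_ne_one q 0).symm)
  have key (m : {m : ℤ // Y = .X → 0 ≤ m}) :
      entry (Idx.zero m) (finOp q α * finOp q α.partner) ≠ 0 ↔ m.1 = α.m + α.i₁ := by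
    simp only [finOp, Idx.partner, termOp_eq, wshift_mul, entry, LinearMap.comp_apply,
      LinearMap.applyₗ_apply_apply, wshift_single, Finsupp.lapply_apply, Finsupp.single_apply,
      Prod.mk_add_mk, Prod.mk.injEq, Idx.zero, Pi.single_apply]
    by_cases h : m.1 = α.m + α.i₁
    · have e : α.m + α.i₁ + ((α.j₁ : ℤ) - α.i₁) = α.m + α.j₁ := by ring
      simp only [h, e, add_sub_cancel_right, if_true, Nat.cast_zero, add_zero, sub_zero]
      rw [if_pos (by constructor <;> ring)]
      simp only [iff_true, one_mul, mul_one]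
      exact mul_ne_zero (mul_ne_zero (mul_ne_zero (hw _) (pow_ne_zero _ (zpow_ne_zero _ hq)))
        (pow_ne_zero _ (zpow_ne_zero _ hq))) (mul_ne_zero (mul_ne_zero (hw _)
          (pow_ne_zero _ (zpow_ne_zero _ hq))) (pow_ne_zero _ (zpow_ne_zero _ hq)))
    · rw [if_neg (c := m.1 + _ - _ = α.m) (by simp; omega)]
      simp [h]
  let m₀ : {m : ℤ // Y = .X → 0 ≤ m} := ⟨α.m + α.i₁, fun h => by have := α.hm h; positivity⟩
  rw [nuMul, nu, finsum_eq_single _ m₀ fun m hm => ?_]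
  · exact mul_ne_zero h1 (mul_ne_zero (mul_ne_zero (inv_ne_zero (entry_finOp_ne_zero q _))
      ((key m₀).2 rfl)) (zpow_ne_zero _ hq))
  · refine mul_eq_zero_of_left (mul_eq_zero_of_right _ (not_ne_iff.1 fun h => hm ?_)) _
    exact Subtype.ext ((key m).1 h)

theorem form_partner_ne_zero (q : Par) {Y₁ Y₂ : QSpace} (p : Idx Y₁ × Idx Y₂) :
    form q (Finsupp.single p 1) (Finsupp.single (p.1.partner, p.2.partner) 1) ≠ 0 := by
  rw [form, Finsupp.sum_single_index (by simp), Finsupp.sum_single_index (by simp), one_mul,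
    one_mul]
  exact mul_ne_zero (nuMul_partner_ne_zero q p.1.partner) (nuMul_partner_ne_zero q p.2)

/-- The basis of the finite functions is dual to the coefficients up to nonzero scalars, so pairing
with one basis vector recovers one coefficient. -/
theorem pair_partner (q : Par) {Y₁ Y₂ : QSpace} (K : Dist₂ Y₁ Y₂) (p : Idx Y₁ × Idx Y₂) :
    pair q K (Finsupp.single (p.1.partner, p.2.partner) 1) =
      K p * form q (Finsupp.single p 1) (Finsupp.single (p.1.partner, p.2.partner) 1) := by
  rw [pair]
  refine finsum_eq_single _ p fun r hr => ?_
  by_contra h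
  have h := right_ne_zero_of_mul h
  rw [form, Finsupp.sum_single_index (by simp), Finsupp.sum_single_index (by simp), one_mul,
    one_mul] at h
  have h1 := nuMul_ne_zero q _ _ (left_ne_zero_of_mul h)
  have h2 := nuMul_ne_zero q _ _ (right_ne_zero_of_mul h)
  simp only [Idx.partner] at h1 h2
  apply hr
  ext <;> omega

theorem IsPolynomial.isLaurent {q : Par} {Y₁ Y₂ : QSpace} {f : ℂˣ → Dist₂ Y₁ Y₂}
    (hf : IsPolynomial q f) (p : Idx Y₁ × Idx Y₂) : IsLaurent fun x => f x p := by
  have h : IsLaurent fun x => pair q (f x) (Finsupp.single (p.1.partner, p.2.partner) 1) := hf _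
  have h' := h.mul (isLaurent_const
    (form q (Finsupp.single p 1) (Finsupp.single (p.1.partner, p.2.partner) 1))⁻¹)
  simpa only [pair_partner, mul_assoc, mul_inv_cancel₀ (form_partner_ne_zero q p), mul_one] using h'

theorem eq_of_interpolates {q : Par} {Y₁ Y₂ : QSpace} {f g : ℂˣ → Dist₂ Y₁ Y₂}
    (hf : IsPolynomial q f) (hg : IsPolynomial q g) (hf' : Interpolates q f)
    (hg' : Interpolates q g) : f = g := by
  funext x p
  refine sub_eq_zero.1 (((hf.isLaurent p).sub (hg.isLaurent p)).eq_zero (qUnit_pow_injective q)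
    (fun l => ?_) x)
  rw [hf' l, hg' l, sub_self]

/-- A continuous linear functional on distributions depends on finitely many coefficients. -/
theorem exists_finset_sum {ι : Type*} (T : (ι → ℂ) →L[ℂ] ℂ) :
    ∃ (s : Finset ι) (c : ι → ℂ), ∀ K, T K = ∑ i ∈ s, K i * c i := by
  classical
  obtain ⟨s, u, hu, hs⟩ := isOpen_pi_iff.1 ((Metric.isOpen_ball (x := (0 : ℂ)) (ε := 1)).preimage
    T.continuous) 0 (by simp)
  -- Functions vanishing on `s` form a subspace inside a neighbourhood that `T` maps into the unit
  -- ball. Rescaling a function with `T K ≠ 0` would give the value `1`, which is outside the ball.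
  have h0 (K : ι → ℂ) (hK : ∀ i ∈ s, K i = 0) : T K = 0 := by
    by_contra h
    have h1 : (T K)⁻¹ • K ∈ (s : Set ι).pi u := fun i hi => by
      rw [Pi.smul_apply, hK i hi, smul_zero]
      exact (hu i hi).2
    have h2 := hs h1
    rw [Set.mem_preimage, map_smul, smul_eq_mul, inv_mul_cancel₀ h] at h2
    simp at h2
  refine ⟨s, fun i => T (Pi.single i 1), fun K => ?_⟩
  have h := h0 (K - ∑ i ∈ s, K i • Pi.single i (1 : ℂ)) fun i hi => by
    simp [Finset.sum_apply, Pi.single_apply, hi]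
  rw [map_sub, map_sum, sub_eq_zero] at h
  rw [h]
  exact Finset.sum_congr rfl fun i _ => by rw [map_smul, smul_eq_mul]

theorem IsPolynomial.isInvariant {q : Par} {Y₁ Y₂ : QSpace} {f : ℂˣ → Dist₂ Y₁ Y₂}
    (hf : IsPolynomial q f) (hf' : Interpolates q f) (x : ℂˣ) : IsInvariant q (f x) := by
  intro u
  obtain ⟨T, hT⟩ := exists_act₂_extension q Y₁ Y₂ u
  refine ⟨T, hT, funext fun p => ?_⟩
  obtain ⟨s, c, hs⟩ := exists_finset_sum ((ContinuousLinearMap.proj p).comp T)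
  -- Continuity of `T` makes this a finite combination of coefficients of `f x`.
  have hL : IsLaurent fun x => T (f x) p := by
    have : (fun x => T (f x) p) = fun x => ∑ i ∈ s, f x i * c i := funext fun x => hs (f x)
    rw [this]
    exact IsLaurent.sum fun i _ => (hf.isLaurent i).mul (isLaurent_const _)
  refine hL.eq_zero (qUnit_pow_injective q) (fun l => ?_) x
  rw [hf' l, hT, (((polInvariant_k22 q Y₁ Y₂ u).pow l).mul ((polInvariant_k11 q Y₁ Y₂ u).pow l)).act,
    map_zero, Pi.zero_apply]

end QKernel

theorem proposition6p7 (q : QKernel.Par) (Y₁ Y₂ : QKernel.QSpace)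
    (hY : Y₁ = QKernel.QSpace.X ∨ Y₂ = QKernel.QSpace.X) :
    (∃! f : ℂˣ → QKernel.Dist₂ Y₁ Y₂, QKernel.IsPolynomial q f ∧ QKernel.Interpolates q f) ∧
    ∀ f : ℂˣ → QKernel.Dist₂ Y₁ Y₂, QKernel.IsPolynomial q f → QKernel.Interpolates q f →
      ∀ z : ℂˣ, QKernel.IsInvariant q (f z) := by
  have h1 := QKernel.isPolynomial_of_isLaurent q (QKernel.isLaurent_kernel q Y₁ Y₂)
  have h2 := QKernel.interpolates_kernel q Y₁ Y₂ hY
  exact ⟨⟨QKernel.kernel q Y₁ Y₂, ⟨h1, h2⟩, fun f hf =>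
    QKernel.eq_of_interpolates hf.1 h1 hf.2 h2⟩, fun f hf hf' z => hf.isInvariant hf' z⟩
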